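/- Let $\otimes$ be either multiplication $u\otimes v=uv$ or the Łukasiewicz tensor $u\otimes v=\max(0,u+v-1)$ on $[0,1]$, and let $\hom(u,v)=\sup\{w\in[0,1] : u\otimes w\le v\}$. **Enriched categories.** A $[0,1]$-category is a set $X$ with a map $a:X\times X\to[0,1]$ such that $a(x,x)=1$ and $a(x,y)\otimes a(y,z)\le a(x,z)$; its natural order is $x\le y\iff a(x,y)=1$, and $X$ is separated if this order is antisymmetric. A $[0,1]$-functor $f:(X,a)\to(Y,b)$ is a map with $a(x,y)\le b(f(x),f(y))$. A weighted diagram in $X$ consists of a $[0,1]$-category $(A,d)$, a $[0,1]$-functor $h:A\to X$ and a weight $\psi:A\to[0,1]$ with $d(z,z')\otimes\psi(z')\le\psi(z)$; a colimit of it is an $x_0\in X$ with $a(x_0,x)=\inf_{z\in A}\hom(\psi(z),a(h(z),x))$ for all $x\in X$. $X$ is finitely cocomplete if all weighted diagrams with $A$ finite have colimits, and a $[0,1]$-functor is finitely cocontinuous if it preserves these colimits. $X$ is Cauchy-complete if it has colimits of all weighted diagrams whose weight $\psi$ is a right adjoint distributor, that is, for which there is $\varphi:A\to[0,1]$ with $\varphi(z)\otimes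 d(z,z')\le\varphi(z')$, $\sup_{z}\varphi(z)\otimes\psi(z)=1$ and $\psi(z)\otimes\varphi(z')\le d(z,z')$. A $u$-power of $x\in X$ ($u\in[0,1]$) is an element $p$ with $a(y,p)=\hom(u,a(y,x))$ for all $y$; $X$ is powered if all these exist. **The category $\mathsf A$.** Its objects are the separated, finitely cocomplete, powered $[0,1]$-categories $X$ with an associative and commutative multiplication on $X$, whose unit is the top element and for which multiplication by each $x\in X$ is a finitely cocontinuous $[0,1]$-functor; if $\otimes$ is multiplication, $X$ carries in addition an operation $\ominus:X\times[0,1]\to X$. Its morphisms are the finitely cocontinuous $[0,1]$-functors that preserve the unit, the multiplication, powers by elements of $[0,1]$ and, if $\otimes$ is multiplication, the operation $\ominus$. The unit interval, with structure $\hom$, multiplication $\otimes$ and $u\ominus v=\max(u-v,0)$, is an object of $\mathsf A$. An object $X$ of $\mathsf A$ has enough characters if the $\mathsf A$-morphisms $X\to[0,1]$ separate the points of $X$. Let $\mathsf A_{[0,1],\mathrm{cc}}$ be the full subcategory of $\mathsf A$ on the Cauchy-complete objects having enough characters, and let $\mathsf B_{[0,1],\mathrm{cc}}$ be the category with the same objects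 whose morphisms are the finitely cocontinuous $[0,1]$-functors $f$ with $f(x\cdot x')\le f(x)\cdot f(x')$ for all $x,x'$, where $\cdot$ denotes the multiplication of the objects. **Spaces.** $\mathsf{PosComp}$ is the category of partially ordered compact spaces (compact spaces $X$ with a partial order that is closed in $X\times X$) and monotone continuous maps. For such $X$, let $VX$ be the set of closed upper subsets of $X$, ordered by $\supseteq$, with the topology generated by the sets $\{A : A\cap U\ne\varnothing\}$ ($U$ open lower) and $\{A : A\cap K=\varnothing\}$ ($K$ closed lower). $\mathsf{PosCompDist}$ is the category with the same objects as $\mathsf{PosComp}$ whose morphisms from $X$ to $Y$ are the continuous distributors, i.e. the relations $\varphi$ from $X$ to $Y$ for which $x\mapsto\{y : x\,\varphi\,y\}$ is a monotone continuous map $X\to VY$, with relational composition and with the order relations as identities (this is the Kleisli category of the Vietoris monad $V$). **Theorem.** For each of these two tensors there are equivalences of categories $$\mathsf{PosCompDist}\simeq\mathsf B_{[0,1],\mathrm{cc}}^{\mathrm{op}}\qquad\text{and}\qquad \mathsf{PosComp}\simeq\mathsf A_{[0,1],\mathrm{cc}}^{\mathrm{op}}.$$ -/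

import Mathlib

open CategoryTheory Set
open scoped unitInterval

universe u v w

namespace UnitDuality

/-! ### Quantale structures on the unit interval -/

/-- A (commutative) quantale structure on the complete lattice `[0,1]` with neutral element `1`. -/
structure UnitQuantale where
  ten : I → I → I
  ten_comm : ∀ a b, ten a b = ten b a
  ten_assoc : ∀ a b c, ten (ten a b) c = ten a (ten b c)
  ten_one : ∀ a, ten a 1 = a
  ten_sSup : ∀ (a : I) (S : Set I), ten a (sSup S) = sSup (ten a '' S)

namespace UnitQuantale

variable (T : UnitQuantale)

/-- The internal hom: `T.hom a` is the right adjoint of `T.ten a`. -/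
noncomputable def hom (a b : I) : I := sSup {c | T.ten a c ≤ b}

theorem ten_mono_right (a : I) {b c : I} (h : b ≤ c) : T.ten a b ≤ T.ten a c := by
  have hs : sSup ({b, c} : Set I) = c := by rw [sSup_pair]; exact sup_eq_right.2 h
  rw [← hs, T.ten_sSup]
  exact le_sSup ⟨b, by simp, rfl⟩

theorem ten_iSup {ι : Type*} (a : I) (f : ι → I) : T.ten a (⨆ i, f i) = ⨆ i, T.ten a (f i) := by
  rw [iSup, T.ten_sSup, ← Set.range_comp]; rfl

theorem le_hom_iff {a b c : I} : c ≤ T.hom a b ↔ T.ten a c ≤ b := by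
  constructor
  · intro h
    refine (T.ten_mono_right a h).trans ?_
    rw [hom, T.ten_sSup]
    refine sSup_le ?_
    rintro _ ⟨c, hc, rfl⟩
    exact hc
  · intro h
    exact le_sSup h

theorem ten_hom_le (a b : I) : T.ten a (T.hom a b) ≤ b := T.le_hom_iff.1 le_rfl

end UnitQuantale

theorem ten_sSup_of_continuous (f : I → I) (hf : Continuous f) (hm : Monotone f) (h0 : f 0 = 0)
    (S : Set I) : f (sSup S) = sSup (f '' S) :=
  Monotone.map_sSup_of_continuousAt hf.continuousAt hm h0

/-- The quantale structure on `[0,1]` given by multiplication. -/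
def mulQuantale : UnitQuantale where
  ten a b := a * b
  ten_comm := mul_comm
  ten_assoc := mul_assoc
  ten_one := mul_one
  ten_sSup a S := ten_sSup_of_continuous (fun b => a * b) (by fun_prop)
    (fun b c h => mul_le_mul_right h a) (by simp) S

/-- The Łukasiewicz tensor `max (0, a + b - 1)`. -/
noncomputable def luk (a b : I) : I :=
  ⟨max 0 ((a : ℝ) + b - 1), le_max_left _ _,
    max_le zero_le_one (by linarith [a.2.2, b.2.2])⟩

/-- The quantale structure on `[0,1]` given by the Łukasiewicz tensor. -/
noncomputable def lukQuantale : UnitQuantale where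
  ten := luk
  ten_comm a b := by ext; simp only [luk, add_comm]
  ten_assoc a b c := by
    have ha := a.2.2
    have hc := c.2.2
    ext
    simp only [luk]
    rcases max_cases (0 : ℝ) ((a : ℝ) + b - 1) with h | h <;>
    rcases max_cases (0 : ℝ) ((b : ℝ) + c - 1) with h' | h' <;>
    rw [h.1, h'.1]
    · rw [max_eq_left (by linarith), max_eq_left (by linarith)]
    · rw [max_eq_left (by linarith), max_eq_left (by linarith)]
    · rw [max_eq_left (by linarith), max_eq_left (by linarith)]
    · congr 1; ring
  ten_one a := by
    have ha := a.2.1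
    ext
    simp [luk, ha]
  ten_sSup a S := ten_sSup_of_continuous (luk a)
    (by unfold luk; fun_prop)
    (fun b c h => by
      have h' : (b : ℝ) ≤ c := h
      exact Subtype.mk_le_mk.2 (max_le_max le_rfl (by linarith)))
    (by
      have ha := a.2.2
      ext
      simp [luk, ha]) S

/-- Truncated minus `max (a - b, 0)` on `[0,1]`. -/
noncomputable def truncSub (a b : I) : I :=
  ⟨max ((a : ℝ) - b) 0, le_max_right _ _, max_le (by linarith [a.2.2, b.2.1]) zero_le_one⟩

/-! ### Categories enriched in `[0,1]` -/

/-- A `[0,1]`-category structure on `X`. -/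
class VCat (T : UnitQuantale) (X : Type u) where
  dist' : X → X → I
  one_le' : ∀ x, 1 ≤ dist' x x
  trans' : ∀ x y z, T.ten (dist' x y) (dist' y z) ≤ dist' x z

section VCat

variable (T : UnitQuantale) {X : Type u} {Y : Type v} [VCat T X] [VCat T Y]

/-- The structure map `a : X × X → [0,1]` of a `[0,1]`-category. -/
def dist (x y : X) : I := VCat.dist' (T := T) x y

/-- The natural order of a `[0,1]`-category. -/
def NatLE (x y : X) : Prop := 1 ≤ dist T x y

/-- `[0,1]`-functors. -/
def IsVFunctor (f : X → Y) : Prop := ∀ x y, dist T x y ≤ dist T (f x) (f y)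

/-- `[0,1]`-distributors `ψ : X ⇸ G` into the one-element `[0,1]`-category `G = (1, 1)`. -/
def IsWeight (ψ : X → I) : Prop := ∀ x y, T.ten (dist T x y) (ψ y) ≤ ψ x

/-- `[0,1]`-distributors `φ : G ⇸ X`. -/
def IsCoweight (φ : X → I) : Prop := ∀ x y, T.ten (φ x) (dist T x y) ≤ φ y

/-- The distributor `ψ : X ⇸ G` is right adjoint: there is a distributor `φ : G ⇸ X` with
`1_G ≤ ψ · φ` and `φ · ψ ≤ 1_X`, where the identity distributor `1_X` is the structure of `X`. -/
def IsRightAdjointWeight (ψ : X → I) : Prop :=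
  ∃ φ : X → I, IsCoweight T φ ∧ 1 ≤ (⨆ x, T.ten (φ x) (ψ x)) ∧
    ∀ x y, T.ten (ψ x) (φ y) ≤ dist T x y

/-- `x₀` is a colimit of the diagram `h : A → X` weighted by `ψ : A ⇸ G`. -/
def IsColimit {A : Type w} (h : A → X) (ψ : A → I) (x₀ : X) : Prop :=
  ∀ x, dist T x₀ x = ⨅ z, T.hom (ψ z) (dist T (h z) x)

/-- `p` is the `a`-power of `x`. -/
def IsPower (x : X) (a : I) (p : X) : Prop := ∀ y, dist T y p = T.hom a (dist T y x)

variable (X)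

/-- `X` is separated: its natural order is antisymmetric. -/
def Separated : Prop := ∀ x y : X, NatLE T x y → NatLE T y x → x = y

/-- Every weighted colimit diagram whose index category has a finite underlying set has a
colimit in `X`. -/
def FinitelyCocomplete : Prop :=
  ∀ (A : Type) [Finite A] [VCat T A] (h : A → X) (ψ : A → I), IsVFunctor T h → IsWeight T ψ →
    ∃ x₀, IsColimit T h ψ x₀

/-- Every diagram weighted by a right adjoint distributor has a colimit in `X`. -/
def CauchyComplete : Prop :=
  ∀ (A : Type u) [VCat T A] (h : A → X) (ψ : A → I), IsVFunctor T h → IsWeight T ψ →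
    IsRightAdjointWeight T ψ → ∃ x₀, IsColimit T h ψ x₀

/-- `X` has all powers by elements of `[0,1]`. -/
def Powered : Prop := ∀ (x : X) (a : I), ∃ p, IsPower T x a p

variable {X}

/-- Finitely cocontinuous `[0,1]`-functors. -/
structure IsFinCocontinuous (f : X → Y) : Prop where
  isVFunctor : IsVFunctor T f
  preserves : ∀ (A : Type) [Finite A] [VCat T A] (h : A → X) (ψ : A → I),
    IsVFunctor T h → IsWeight T ψ → ∀ x₀, IsColimit T h ψ x₀ → IsColimit T (f ∘ h) ψ (f x₀)

end VCat

/-! ### Commutative monoids in separated finitely cocomplete `[0,1]`-categories -/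

/-- A commutative monoid in the category of separated finitely cocomplete `[0,1]`-categories,
with unit the top element. If `m` holds, it carries in addition an operation
`⊖ : X × [0,1] → X`; if `m` is false, the last field is void. -/
class CoctsMonoid (T : UnitQuantale) (m : Prop) (X : Type u) extends VCat T X where
  separated : Separated T X
  finitelyCocomplete : FinitelyCocomplete T X
  mul' : X → X → X
  one' : X
  mul_comm' : ∀ x y, mul' x y = mul' y x
  mul_assoc' : ∀ x y z, mul' (mul' x y) z = mul' x (mul' y z)
  mul_one' : ∀ x, mul' x one' = x
  le_one' : ∀ x, NatLE T x one'
  mul_cocontinuous' : ∀ x, IsFinCocontinuous T (mul' x)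
  minus' : m → X → I → X

section CoctsMonoid

variable (T : UnitQuantale) (m : Prop) {X : Type u} {Y : Type v} {Z : Type w}
  [CoctsMonoid T m X] [CoctsMonoid T m Y] [CoctsMonoid T m Z]

/-- The multiplication. -/
def cmul (x y : X) : X := CoctsMonoid.mul' T m x y

variable (X) in
/-- The unit. -/
def cunit : X := CoctsMonoid.one' T m

/-- The operation `⊖`, present if `m` holds. -/
def cminus (hm : m) (x : X) (a : I) : X := CoctsMonoid.minus' (T := T) hm x a

/-- Finitely cocontinuous `[0,1]`-functors that laxly preserve the multiplication. -/
structure IsLaxHom (f : X → Y) : Prop where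
  cocontinuous : IsFinCocontinuous T f
  map_mul_le : ∀ x y, NatLE T (f (cmul T m x y)) (cmul T m (f x) (f y))

/-- Finitely cocontinuous `[0,1]`-functors that preserve unit, multiplication, powers by
elements of `[0,1]` and, if `m` holds, the operation `⊖`. -/
structure IsPowHom (f : X → Y) : Prop where
  cocontinuous : IsFinCocontinuous T f
  map_mul : ∀ x y, f (cmul T m x y) = cmul T m (f x) (f y)
  map_one : f (cunit T m X) = cunit T m Y
  map_power : ∀ (x : X) (a : I) (p : X), IsPower T x a p → IsPower T (f x) a (f p)
  map_minus : ∀ (hm : m) (x : X) (a : I), f (cminus T m hm x a) = cminus T m hm (f x) a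

variable {T m}

theorem IsFinCocontinuous.id {X : Type u} [VCat T X] : IsFinCocontinuous T (id : X → X) :=
  ⟨fun _ _ => le_rfl, fun _ _ _ _ _ _ _ _ hx => hx⟩

theorem IsFinCocontinuous.comp {X : Type u} {Y : Type v} {Z : Type w} [VCat T X] [VCat T Y]
    [VCat T Z] {g : Y → Z} {f : X → Y} (hg : IsFinCocontinuous T g)
    (hf : IsFinCocontinuous T f) : IsFinCocontinuous T (g ∘ f) :=
  ⟨fun x y => (hf.1 x y).trans (hg.1 _ _), fun A _ _ h ψ hh hψ x₀ hx =>
    hg.2 A (f ∘ h) ψ (fun x y => (hh x y).trans (hf.1 _ _)) hψ _ (hf.2 A h ψ hh hψ x₀ hx)⟩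

theorem NatLE.trans {X : Type u} [VCat T X] {x y z : X} (h : NatLE T x y) (h' : NatLE T y z) :
    NatLE T x z := by
  have e : dist T x y = 1 := le_antisymm (dist T x y).2.2 h
  have e' : dist T y z = 1 := le_antisymm (dist T y z).2.2 h'
  have t : T.ten (dist T x y) (dist T y z) ≤ dist T x z := VCat.trans' x y z
  rw [e, e', T.ten_one] at t
  exact t

theorem IsLaxHom.id : IsLaxHom T m (id : X → X) :=
  ⟨.id, fun _ _ => VCat.one_le' _⟩

theorem IsLaxHom.comp {g : Y → Z} {f : X → Y} (hg : IsLaxHom T m g) (hf : IsLaxHom T m f) :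
    IsLaxHom T m (g ∘ f) :=
  ⟨hg.1.comp hf.1, fun x y =>
    NatLE.trans (show NatLE T (g (f (cmul T m x y))) (g (cmul T m (f x) (f y))) from
      le_trans (hf.2 x y) (hg.1.isVFunctor _ _)) (hg.2 _ _)⟩

theorem IsPowHom.id : IsPowHom T m (id : X → X) :=
  ⟨.id, fun _ _ => rfl, rfl, fun _ _ _ h => h, fun _ _ _ => rfl⟩

theorem IsPowHom.comp {g : Y → Z} {f : X → Y} (hg : IsPowHom T m g) (hf : IsPowHom T m f) :
    IsPowHom T m (g ∘ f) where
  cocontinuous := hg.1.comp hf.1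
  map_mul x y := by simp [hf.map_mul, hg.map_mul]
  map_one := by simp [hf.map_one, hg.map_one]
  map_power x a p h := hg.map_power _ _ _ (hf.map_power _ _ _ h)
  map_minus hm x a := by simp [hf.map_minus, hg.map_minus]

end CoctsMonoid

/-! ### The unit interval as an object -/

section UnitInterval

variable (T : UnitQuantale)

/-- `[0,1]` as a `[0,1]`-category with structure `hom`. -/
noncomputable instance : VCat T I where
  dist' := T.hom
  one_le' x := T.le_hom_iff.2 (T.ten_one x).le
  trans' x y z := T.le_hom_iff.2 (by
    rw [← T.ten_assoc, T.ten_comm, T.ten_comm x]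
    refine le_trans ?_ (T.ten_hom_le y z)
    rw [T.ten_comm (T.hom y z), T.ten_comm (T.hom x y)]
    rw [T.ten_comm _ (T.hom y z), T.ten_comm y]
    exact T.ten_mono_right _ (T.ten_hom_le x y))

theorem unit_separated : Separated T I := fun x y h h' => by
  have h1 := T.le_hom_iff.1 h
  have h2 := T.le_hom_iff.1 h'
  rw [T.ten_one] at h1 h2
  exact le_antisymm h1 h2

theorem unit_isColimit {A : Type w} (h ψ : A → I) :
    IsColimit T h ψ (⨆ z, T.ten (h z) (ψ z)) := fun x => by
  refine eq_of_forall_le_iff fun c => ?_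
  change c ≤ T.hom _ x ↔ c ≤ ⨅ z, T.hom (ψ z) (T.hom (h z) x)
  rw [T.le_hom_iff, T.ten_comm, T.ten_iSup, iSup_le_iff, le_iInf_iff]
  refine forall_congr' fun z => ?_
  rw [T.le_hom_iff, T.le_hom_iff, T.ten_comm, T.ten_assoc]

theorem unit_isColimit_unique {A : Type w} {h ψ : A → I} {x₀ : I} (hx : IsColimit T h ψ x₀) :
    x₀ = ⨆ z, T.ten (h z) (ψ z) := by
  have key : ∀ x, dist T x₀ x = dist T (⨆ z, T.ten (h z) (ψ z)) x := fun x =>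
    (hx x).trans (unit_isColimit T h ψ x).symm
  refine unit_separated T _ _ ?_ ?_
  · exact (VCat.one_le' (T := T) (⨆ z, T.ten (h z) (ψ z))).trans (key _).ge
  · exact (VCat.one_le' (T := T) x₀).trans (key _).le

theorem unit_ten_cocontinuous (a : I) : IsFinCocontinuous T (T.ten a) where
  isVFunctor x y := T.le_hom_iff.2 (by
    rw [T.ten_assoc]
    exact T.ten_mono_right a (T.ten_hom_le x y))
  preserves A _ _ h ψ _ _ x₀ hx := by
    have e : T.ten a x₀ = ⨆ z, T.ten ((T.ten a ∘ h) z) (ψ z) := by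
      rw [unit_isColimit_unique T hx, T.ten_iSup]
      exact iSup_congr fun z => (T.ten_assoc _ _ _).symm
    rw [e]
    exact unit_isColimit T _ ψ

/-- `[0,1]` with multiplication the tensor and with truncated minus. -/
noncomputable instance (m : Prop) : CoctsMonoid T m I where
  separated := unit_separated T
  finitelyCocomplete _ _ _ h ψ _ _ := ⟨_, unit_isColimit T h ψ⟩
  mul' := T.ten
  one' := 1
  mul_comm' := T.ten_comm
  mul_assoc' := T.ten_assoc
  mul_one' := T.ten_one
  le_one' x := T.le_hom_iff.2 (T.ten x 1).2.2
  mul_cocontinuous' := unit_ten_cocontinuous T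
  minus' _ := truncSub

end UnitInterval

/-! ### The categories `A`, `A_{[0,1],cc}` and `B_{[0,1],cc}` -/

/-- The category `A` of `[0,1]`-powered commutative monoids in the category of separated
finitely cocomplete `[0,1]`-categories, with the operation `⊖` if `m` holds. -/
structure ACat (T : UnitQuantale) (m : Prop) : Type (u + 1) where
  carrier : Type u
  [str : CoctsMonoid T m carrier]
  powered : Powered T carrier

attribute [instance] ACat.str

namespace ACat

variable {T : UnitQuantale} {m : Prop}

/-- Morphisms of `A`. -/
@[ext]
structure Hom (X Y : ACat.{u} T m) where
  toFun : X.carrier → Y.carrier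
  isPowHom : IsPowHom T m toFun

instance : Category (ACat.{u} T m) where
  Hom := Hom
  id X := ⟨id, .id⟩
  comp f g := ⟨g.toFun ∘ f.toFun, g.isPowHom.comp f.isPowHom⟩

/-- The morphisms into `[0,1]` separate the points. -/
def HasEnoughCharacters (X : ACat.{u} T m) : Prop :=
  ∀ x y : X.carrier, (∀ φ : X.carrier → I, IsPowHom T m φ → φ x = φ y) → x = y

/-- The Cauchy-complete objects having enough characters. -/
def IsCC : ObjectProperty (ACat.{u} T m) := fun X =>
  CauchyComplete T X.carrier ∧ X.HasEnoughCharacters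

end ACat

/-- The full subcategory `A_{[0,1],cc}` of `A`. -/
abbrev ACC (T : UnitQuantale) (m : Prop) := (ACat.IsCC (T := T) (m := m)).FullSubcategory

/-- The category `B_{[0,1],cc}`, with the same objects as `A_{[0,1],cc}`. -/
structure BCC (T : UnitQuantale) (m : Prop) : Type (u + 1) where
  obj : ACat.{u} T m
  property : ACat.IsCC obj

namespace BCC

variable {T : UnitQuantale} {m : Prop}

/-- Morphisms of `B_{[0,1],cc}`. -/
@[ext]
structure Hom (X Y : BCC.{u} T m) where
  toFun : X.obj.carrier → Y.obj.carrier
  isLaxHom : IsLaxHom T m toFun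

instance : Category (BCC.{u} T m) where
  Hom := Hom
  id X := ⟨id, .id⟩
  comp f g := ⟨g.toFun ∘ f.toFun, g.isLaxHom.comp f.isLaxHom⟩

end BCC

/-! ### Partially ordered compact spaces -/

/-- Partially ordered compact spaces: compact spaces with a partial order that is closed in the
product. -/
structure PosComp : Type (u + 1) where
  carrier : Type u
  [top : TopologicalSpace carrier]
  [compact : CompactSpace carrier]
  [order : PartialOrder carrier]
  [closed : OrderClosedTopology carrier]

attribute [instance] PosComp.top PosComp.compact PosComp.order PosComp.closed

/-- Morphisms of `PosComp` are the monotone continuous maps. -/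
instance : Category PosComp.{u} where
  Hom X Y := X.carrier →Co Y.carrier
  id X := ContinuousOrderHom.id X.carrier
  comp f g := g.comp f

section Vietoris

variable (X : Type u) [TopologicalSpace X] [PartialOrder X]

/-- The set `VX` of closed upper subsets of `X`. -/
@[ext]
structure Vietoris where
  carrier : Set X
  isClosed : IsClosed carrier
  isUpper : IsUpperSet carrier

/-- The order on `VX` is containment `⊇`. -/
instance : PartialOrder (Vietoris X) where
  le A B := B.carrier ⊆ A.carrier
  le_refl _ := Subset.rfl
  le_trans _ _ _ h h' := h'.trans h
  le_antisymm _ _ h h' := Vietoris.ext (h'.antisymm h)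

/-- The topology of `VX`. -/
instance : TopologicalSpace (Vietoris X) :=
  TopologicalSpace.generateFrom
    ({S | ∃ U : Set X, IsOpen U ∧ IsLowerSet U ∧
        S = {A : Vietoris X | (A.carrier ∩ U).Nonempty}} ∪
     {S | ∃ K : Set X, IsClosed K ∧ IsLowerSet K ∧
        S = {A : Vietoris X | A.carrier ∩ K = ∅}})

end Vietoris

section Kleisli

variable {X : Type u} {Y : Type v} {Z : Type w}
  [TopologicalSpace X] [PartialOrder X] [TopologicalSpace Y] [PartialOrder Y]
  [TopologicalSpace Z] [PartialOrder Z]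

theorem continuous_vietoris {X : Type u} {Y : Type v} [TopologicalSpace X]
    [TopologicalSpace Y] [PartialOrder Y] {φ : X → Vietoris Y}
    (h₁ : ∀ U : Set Y, IsOpen U → IsLowerSet U → IsOpen {x | ((φ x).carrier ∩ U).Nonempty})
    (h₂ : ∀ K : Set Y, IsClosed K → IsLowerSet K → IsOpen {x | (φ x).carrier ∩ K = ∅}) :
    Continuous φ := by
  refine continuous_generateFrom_iff.2 ?_
  rintro _ (⟨U, hU, hU', rfl⟩ | ⟨K, hK, hK', rfl⟩)
  · exact h₁ U hU hU'
  · exact h₂ K hK hK'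

/-- A continuous distributor `X ⇸ Y`, given by its monotone continuous map `φ : X → VY`; as a
relation, `x φ y` means `y ∈ φ x`. -/
abbrev ContDist (X : Type u) (Y : Type v) [TopologicalSpace X] [PartialOrder X]
    [TopologicalSpace Y] [PartialOrder Y] := X →Co Vietoris Y

/-- The relation underlying a continuous distributor. -/
def ContDist.Rel (φ : ContDist X Y) (x : X) (y : Y) : Prop := y ∈ (φ x).carrier

theorem ContDist.rel_of_le (φ : ContDist X Y) {x x' : X} {y y' : Y} (hx : x' ≤ x) (hy : y ≤ y')
    (h : φ.Rel x y) : φ.Rel x' y' :=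
  (φ x').isUpper hy (φ.monotone' hx h)

theorem ContDist.isOpen_hit (φ : ContDist X Y) {U : Set Y} (hU : IsOpen U) (hU' : IsLowerSet U) :
    IsOpen {x | ∃ y ∈ U, φ.Rel x y} := by
  have h : IsOpen {A : Vietoris Y | (A.carrier ∩ U).Nonempty} :=
    TopologicalSpace.isOpen_generateFrom_of_mem (Or.inl ⟨U, hU, hU', rfl⟩)
  convert h.preimage φ.continuous_toFun using 1
  ext x
  exact ⟨fun ⟨y, h, h'⟩ => ⟨y, h', h⟩, fun ⟨y, h, h'⟩ => ⟨y, h', h⟩⟩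

theorem ContDist.isClosed_hit (φ : ContDist X Y) {K : Set Y} (hK : IsClosed K)
    (hK' : IsLowerSet K) : IsClosed {x | ∃ y ∈ K, φ.Rel x y} := by
  have h : IsOpen {A : Vietoris Y | A.carrier ∩ K = ∅} :=
    TopologicalSpace.isOpen_generateFrom_of_mem (Or.inr ⟨K, hK, hK', rfl⟩)
  rw [← isOpen_compl_iff]
  convert h.preimage φ.continuous_toFun using 1
  ext x
  simp only [mem_compl_iff, mem_ofPred_eq, mem_preimage, ← not_nonempty_iff_eq_empty, not_iff_not]
  exact ⟨fun ⟨y, h, h'⟩ => ⟨y, h', h⟩, fun ⟨y, h, h'⟩ => ⟨y, h', h⟩⟩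

/-- The graph of a continuous distributor between partially ordered compact spaces is closed. -/
theorem ContDist.isClosed_graph [CompactSpace Y] [OrderClosedTopology Y] (φ : ContDist X Y) :
    IsClosed {p : X × Y | φ.Rel p.1 p.2} := by
  rw [← isOpen_compl_iff, isOpen_iff_mem_nhds]
  rintro ⟨x, y⟩ hxy
  have hxy' : ¬ φ.Rel x y := hxy
  -- a closed neighbourhood `N` of `y` with no point of `N` above a point related to `x`
  have hC : IsClosed {q : Y × Y | φ.Rel x q.1 ∧ q.1 ≤ q.2} :=
    ((φ x).isClosed.preimage continuous_fst).inter
      (isClosed_le continuous_fst continuous_snd)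
  have hD : IsClosed (Prod.snd '' {q : Y × Y | φ.Rel x q.1 ∧ q.1 ≤ q.2}) :=
    isClosedMap_snd_of_compactSpace _ hC
  have hy : y ∈ (Prod.snd '' {q : Y × Y | φ.Rel x q.1 ∧ q.1 ≤ q.2})ᶜ := by
    rintro ⟨⟨a, b⟩, ⟨h1, h2⟩, rfl⟩
    exact hxy' (φ.rel_of_le le_rfl h2 h1)
  obtain ⟨N, hN, hNc, hNs⟩ := exists_mem_nhds_isClosed_subset (hD.isOpen_compl.mem_nhds hy)
  let K : Set Y := {a | ∃ b ∈ N, a ≤ b}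
  have hK : IsClosed K := by
    have h1 : IsClosed {q : Y × Y | q.2 ∈ N ∧ q.1 ≤ q.2} :=
      (hNc.preimage continuous_snd).inter (isClosed_le continuous_fst continuous_snd)
    convert isClosedMap_fst_of_compactSpace _ h1 using 1
    ext a
    constructor
    · rintro ⟨b, hb, hab⟩
      exact ⟨(a, b), ⟨hb, hab⟩, rfl⟩
    · rintro ⟨⟨a, b⟩, ⟨hb, hab⟩, rfl⟩
      exact ⟨b, hb, hab⟩
  have hK' : IsLowerSet K := fun a a' h ⟨b, hb, hab⟩ => ⟨b, hb, h.trans hab⟩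
  have hO := (φ.isClosed_hit hK hK').isOpen_compl
  have hx : x ∈ {x | ∃ y ∈ K, φ.Rel x y}ᶜ := by
    rintro ⟨a, ⟨b, hb, hab⟩, ha⟩
    exact hNs hb ⟨(a, b), ⟨ha, hab⟩, rfl⟩
  filter_upwards [prod_mem_nhds (hO.mem_nhds hx) hN] with q hq hrel
  exact hq.1 ⟨q.2, ⟨q.2, hq.2, le_rfl⟩, hrel⟩

/-- The identity distributor is the order relation. -/
def ContDist.id (X : Type u) [TopologicalSpace X] [PartialOrder X] [OrderClosedTopology X] :
    ContDist X X where
  toFun x := ⟨Ici x, isClosed_Ici, isUpperSet_Ici x⟩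
  monotone' _ _ h := Ici_subset_Ici.2 h
  continuous_toFun := continuous_vietoris
    (fun U hU hU' => by
      convert hU using 1
      ext x
      exact ⟨fun ⟨_, h, h'⟩ => hU' h h', fun h => ⟨x, le_rfl, h⟩⟩)
    (fun K hK hK' => by
      convert hK.isOpen_compl using 1
      ext x
      simp only [mem_ofPred_eq, ← not_nonempty_iff_eq_empty, mem_compl_iff, not_iff_not]
      exact ⟨fun ⟨_, h, h'⟩ => hK' h h', fun h => ⟨x, le_rfl, h⟩⟩)

/-- Composition of continuous distributors is composition of relations. -/
def ContDist.comp [CompactSpace Y] [OrderClosedTopology Y] [CompactSpace Z]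
    [OrderClosedTopology Z] (ψ : ContDist Y Z) (φ : ContDist X Y) : ContDist X Z where
  toFun x := ⟨{z | ∃ y, φ.Rel x y ∧ ψ.Rel y z}, by
      have h : IsClosed {p : Y × Z | φ.Rel x p.1 ∧ ψ.Rel p.1 p.2} :=
        ((φ x).isClosed.preimage continuous_fst).inter ψ.isClosed_graph
      convert isClosedMap_snd_of_compactSpace _ h using 1
      ext z
      constructor
      · rintro ⟨y, hy, hz⟩
        exact ⟨(y, z), ⟨hy, hz⟩, rfl⟩
      · rintro ⟨⟨y, z⟩, ⟨hy, hz⟩, rfl⟩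
        exact ⟨y, hy, hz⟩,
    fun _ _ h ⟨y, hy, hz⟩ => ⟨y, hy, ψ.rel_of_le le_rfl h hz⟩⟩
  monotone' _ _ h := fun _ ⟨y, hy, hz⟩ => ⟨y, φ.rel_of_le h le_rfl hy, hz⟩
  continuous_toFun := continuous_vietoris
    (fun U hU hU' => by
      convert φ.isOpen_hit (ψ.isOpen_hit hU hU')
        (fun y y' h ⟨z, hz, hyz⟩ => ⟨z, hz, ψ.rel_of_le h le_rfl hyz⟩) using 1
      ext x
      exact ⟨fun ⟨z, ⟨y, h, h'⟩, hz⟩ => ⟨y, ⟨z, hz, h'⟩, h⟩,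
        fun ⟨y, ⟨z, hz, h'⟩, h⟩ => ⟨z, ⟨y, h, h'⟩, hz⟩⟩)
    (fun K hK hK' => by
      convert (φ.isClosed_hit (ψ.isClosed_hit hK hK')
        (fun y y' h ⟨z, hz, hyz⟩ => ⟨z, hz, ψ.rel_of_le h le_rfl hyz⟩)).isOpen_compl using 1
      ext x
      simp only [mem_ofPred_eq, ← not_nonempty_iff_eq_empty, mem_compl_iff, not_iff_not]
      exact ⟨fun ⟨z, ⟨y, h, h'⟩, hz⟩ => ⟨y, ⟨z, hz, h'⟩, h⟩,
        fun ⟨y, ⟨z, hz, h'⟩, h⟩ => ⟨z, ⟨y, h, h'⟩, hz⟩⟩)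

theorem ContDist.rel_comp [CompactSpace Y] [OrderClosedTopology Y] [CompactSpace Z]
    [OrderClosedTopology Z] (ψ : ContDist Y Z) (φ : ContDist X Y) (x : X) (z : Z) :
    (ψ.comp φ).Rel x z ↔ ∃ y, φ.Rel x y ∧ ψ.Rel y z := Iff.rfl

theorem ContDist.rel_id [OrderClosedTopology X] (x y : X) :
    (ContDist.id X).Rel x y ↔ x ≤ y := Iff.rfl

theorem ContDist.ext_rel {φ ψ : ContDist X Y} (h : ∀ x y, φ.Rel x y ↔ ψ.Rel x y) : φ = ψ :=
  DFunLike.ext _ _ fun x => Vietoris.ext (Set.ext (h x))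

end Kleisli

/-- The category of partially ordered compact spaces and continuous distributors, that is, the
Kleisli category of the Vietoris monad on `PosComp`. -/
structure PosCompDist : Type (u + 1) where
  space : PosComp.{u}

instance : Category PosCompDist.{u} where
  Hom X Y := ContDist X.space.carrier Y.space.carrier
  id X := ContDist.id X.space.carrier
  comp φ ψ := ContDist.comp ψ φ
  id_comp φ := ContDist.ext_rel fun x _ =>
    ⟨fun ⟨_, h, h'⟩ => φ.rel_of_le h le_rfl h', fun h => ⟨x, le_refl x, h⟩⟩
  comp_id φ := ContDist.ext_rel fun _ y =>
    ⟨fun ⟨_, h, h'⟩ => φ.rel_of_le le_rfl h' h, fun h => ⟨y, h, le_refl y⟩⟩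
  assoc _ _ _ := ContDist.ext_rel fun _ _ =>
    ⟨fun ⟨z, ⟨w, h, h'⟩, h''⟩ => ⟨w, h, z, h', h''⟩,
      fun ⟨w, h, z, h', h''⟩ => ⟨z, ⟨w, h, h'⟩, h''⟩⟩

end UnitDuality

/-! Both equivalences send a space `X` to the antitone continuous functions `X → [0,1]` with
pointwise structure. A distributor `φ : X ⇸ Y` acts by `f ↦ (x ↦ sup of f over φ x)`, and a monotone
map acts by composition. Antitone functions fit because a closed upper set is determined by the
suprema of such functions over it (ordered Urysohn lemma, `exists_antitone_continuous`).
Faithfulness follows from this.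

Fullness: fix a point of the source, so that a morphism becomes a functional `Φ` on functions, and
let its support be the set of `y` with `f y ≤ Φ f` for all `f`. If `Φ` is finitely cocontinuous and
laxly multiplicative, then `Φ f` is the supremum of `f` over the support (`eq_iSup_support`): away
from the support there are local cutoff functions with arbitrarily small `Φ`-value, because tensor
powers of a number below `1` become arbitrarily small, and compactness joins finitely many of them.
If `Φ` preserves multiplication and unit, its support has a least element (`exists_support_eq_Ici`)
and `Φ` is evaluation there.

Essential surjectivity: the characters of `X` form a closed subset of the cube `[0,1]^X`, hence a
partially ordered compact space. Evaluation `ev` into functions on this space is isometric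
(`dist_ev`) because enough characters detect the order and powers turn distances into order
relations. Its range is uniformly dense by a Stone–Weierstrass argument (`exists_approx`), and
Cauchy completeness turns density into surjectivity (`ev_surjective`). For the product tensor,
uniform closeness near `0` does not control the quotients that define `hom`. Functions are therefore
first compressed into `[1/2, 1]` and recovered afterwards with `⊖` and a power; this is the role of
`⊖`. -/

open Filter Topology

namespace UnitDuality

/-! ### Partially ordered compact spaces: closures and the ordered Urysohn lemma -/

section LowerPair

variable {Y : Type u} [TopologicalSpace Y] [PartialOrder Y]

/-- The property of pairs of sets along which Urysohn's construction is run. -/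
def LowerPair (C U : Set Y) : Prop := (lowerClosure C : Set Y) ⊆ U ∧ IsLowerSet U

/-- The zeroth approximation is the indicator of the complement of the lower set `U`. Later ones are
midpoints of approximations for pairs that are again `LowerPair`s. -/
theorem monotone_approx (c : Urysohns.CU (X := Y) LowerPair) (n : ℕ) :
    Monotone (c.approx n) := by
  induction n generalizing c with
  | zero =>
    intro x y hxy
    by_cases hy : y ∈ c.U
    · have hx : x ∈ c.U := c.P_C_U.2 hxy hy
      simp [Urysohns.CU.approx, hx, hy]
    · rw [Urysohns.CU.approx_of_notMem_U c 0 hy]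
      exact c.approx_le_one _ _
  | succ n ih =>
    intro x y hxy
    exact midpoint_le_midpoint (ih _ hxy) (ih _ hxy)

theorem monotone_lim (c : Urysohns.CU (X := Y) LowerPair) : Monotone c.lim := fun _ y hxy =>
  ciSup_mono (c.bddAbove_range_approx y) fun n => monotone_approx c n hxy

end LowerPair

section OrderedUrysohn

variable {Y : Type u} [TopologicalSpace Y] [CompactSpace Y] [PartialOrder Y]
  [OrderClosedTopology Y]

theorem isClosed_lowerClosure_of_isClosed {K : Set Y} (hK : IsClosed K) :
    IsClosed (lowerClosure K : Set Y) := by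
  have h1 : IsClosed {q : Y × Y | q.2 ∈ K ∧ q.1 ≤ q.2} :=
    (hK.preimage continuous_snd).inter (isClosed_le continuous_fst continuous_snd)
  convert isClosedMap_fst_of_compactSpace _ h1 using 1
  ext a
  constructor
  · rintro ⟨b, hb, hab⟩
    exact ⟨(a, b), ⟨hb, hab⟩, rfl⟩
  · rintro ⟨⟨a, b⟩, ⟨hb, hab⟩, rfl⟩
    exact ⟨b, hb, hab⟩

theorem isClosed_upperClosure_of_isClosed {K : Set Y} (hK : IsClosed K) :
    IsClosed (upperClosure K : Set Y) := by
  have h1 : IsClosed {q : Y × Y | q.1 ∈ K ∧ q.1 ≤ q.2} :=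
    (hK.preimage continuous_fst).inter (isClosed_le continuous_fst continuous_snd)
  convert isClosedMap_snd_of_compactSpace _ h1 using 1
  ext a
  constructor
  · rintro ⟨b, hb, hab⟩
    exact ⟨(b, a), ⟨hb, hab⟩, rfl⟩
  · rintro ⟨⟨a, b⟩, ⟨hb, hab⟩, rfl⟩
    exact ⟨a, hb, hab⟩

/-- Normality made compatible with the order: `V` is the largest lower set inside `O₁`, and `L` is
the lower closure of the complement of `O₂`. Compactness makes the first open and the second closed.
-/
theorem exists_isOpen_isLowerSet_between {K U : Set Y} (hK : IsClosed K) (hK' : IsLowerSet K)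
    (hU : IsOpen U) (hU' : IsLowerSet U) (hKU : K ⊆ U) :
    ∃ V L : Set Y, IsOpen V ∧ IsLowerSet V ∧ IsClosed L ∧ IsLowerSet L ∧
      K ⊆ V ∧ V ⊆ L ∧ L ⊆ U := by
  obtain ⟨O₁, O₂, h₁, h₂, hKO, hUO, hd⟩ := normal_separation hK hU.isClosed_compl
    (disjoint_compl_right_iff_subset.2 hKU)
  refine ⟨(upperClosure O₁ᶜ : Set Y)ᶜ, lowerClosure O₂ᶜ,
    (isClosed_upperClosure_of_isClosed h₁.isClosed_compl).isOpen_compl,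
    (upperClosure _).upper.compl, isClosed_lowerClosure_of_isClosed h₂.isClosed_compl,
    (lowerClosure _).lower, ?_, ?_, ?_⟩
  · rintro k hk ⟨z, hz, hzk⟩
    exact hz (hKO (hK' hzk hk))
  · intro x hx
    refine subset_lowerClosure fun hx₂ => hx (subset_upperClosure ?_)
    exact fun hx₁ => (Set.disjoint_left.1 hd) hx₁ hx₂
  · rintro x ⟨z, hz, hxz⟩
    refine hU' hxz ?_
    by_contra h
    exact hz (hUO h)

/-- Ordered Urysohn lemma: a closed lower set and a closed upper set that are disjoint are
separated by an antitone continuous function into the unit interval. -/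
theorem exists_antitone_continuous {K A : Set Y} (hK : IsClosed K) (hK' : IsLowerSet K)
    (hA : IsClosed A) (hA' : IsUpperSet A) (hd : Disjoint K A) :
    ∃ f : Y → I, Continuous f ∧ Antitone f ∧ (∀ y ∈ K, f y = 1) ∧ ∀ y ∈ A, f y = 0 := by
  let c : Urysohns.CU (X := Y) LowerPair :=
    { C := K
      U := Aᶜ
      P_C_U := ⟨by
        rw [hK'.lowerClosure]; exact Set.disjoint_left.1 hd, hA'.compl⟩
      closed_C := hK
      open_U := hA.isOpen_compl
      subset := Set.disjoint_left.1 hd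
      -- The closure of the open lower set `V` need not be lower. This is why `LowerPair` constrains
      -- the lower closure of `C` instead of `C` itself; the closed lower set `L` bounds that lower
      -- closure.
      hP := by
        intro c u hc hcu hu _
        obtain ⟨V, L, hV, hV', hL, hL', h₁, h₂, h₃⟩ := exists_isOpen_isLowerSet_between
          (isClosed_lowerClosure_of_isClosed hc) (lowerClosure c).lower hu hcu.2 hcu.1
        have hVL : closure V ⊆ L := closure_minimal h₂ hL
        exact ⟨V, hV, subset_lowerClosure.trans h₁, hVL.trans h₃, ⟨h₁, hV'⟩,
          (lowerClosure_min hVL hL').trans h₃, hcu.2⟩ }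
  refine ⟨fun y => unitInterval.symm ⟨c.lim y, c.lim_mem_Icc y⟩, ?_, ?_, ?_, ?_⟩
  · exact unitInterval.continuous_symm.comp (c.continuous_lim.subtype_mk _)
  · intro x y hxy
    exact unitInterval.symm_le_symm.2 (monotone_lim c hxy)
  · intro y hy
    ext
    simp [c.lim_of_mem_C y hy]
  · intro y hy
    ext
    simp [c.lim_of_notMem_U y (fun h => h hy)]

end OrderedUrysohn

/-! ### Quantale structures on the unit interval -/

namespace UnitQuantale

variable (T : UnitQuantale)

theorem ten_mono {a b c d : I} (h : a ≤ b) (h' : c ≤ d) : T.ten a c ≤ T.ten b d := by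
  refine (T.ten_mono_right a h').trans ?_
  rw [T.ten_comm a, T.ten_comm b]
  exact T.ten_mono_right d h

theorem one_ten (a : I) : T.ten 1 a = a := by rw [T.ten_comm, T.ten_one]

theorem ten_le_left (a b : I) : T.ten a b ≤ a :=
  (T.ten_mono_right a b.2.2).trans (T.ten_one a).le

theorem ten_le_right (a b : I) : T.ten a b ≤ b := by
  rw [T.ten_comm]; exact T.ten_le_left b a

theorem ten_zero (a : I) : T.ten a 0 = 0 :=
  le_antisymm (T.ten_le_right a 0) zero_le

theorem zero_ten (a : I) : T.ten 0 a = 0 := by rw [T.ten_comm, T.ten_zero]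

theorem iSup_ten {ι : Type*} (f : ι → I) (a : I) : T.ten (⨆ i, f i) a = ⨆ i, T.ten (f i) a := by
  simp only [T.ten_comm _ a, T.ten_iSup]

theorem ten_sup (a b c : I) : T.ten a (b ⊔ c) = T.ten a b ⊔ T.ten a c :=
  (show Monotone (T.ten a) from fun _ _ h => T.ten_mono_right a h).map_sup b c

theorem one_le_hom_iff {a b : I} : 1 ≤ T.hom a b ↔ a ≤ b := by
  rw [T.le_hom_iff, T.ten_one]

theorem hom_mono_right (a : I) {b c : I} (h : b ≤ c) : T.hom a b ≤ T.hom a c :=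
  T.le_hom_iff.2 ((T.ten_hom_le a b).trans h)

theorem hom_lt_one {a b : I} (h : b < a) : T.hom a b < 1 :=
  lt_of_not_ge fun h' => h.not_ge (T.one_le_hom_iff.1 h')

theorem hom_iInf {ι : Type*} (a : I) (f : ι → I) : T.hom a (⨅ i, f i) = ⨅ i, T.hom a (f i) :=
  eq_of_forall_le_iff fun c => by simp only [T.le_hom_iff, le_iInf_iff]

theorem hom_comm (a b c : I) : T.hom a (T.hom b c) = T.hom b (T.hom a c) :=
  eq_of_forall_le_iff fun d => by
    simp only [T.le_hom_iff, ← T.ten_assoc, T.ten_comm a b]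

end UnitQuantale

/-- The properties of the tensor, and of the operation `⊖` that is present if `m` holds, on which
the duality rests: continuity, the Archimedean property, and the possibility to bring a function
into a range `[r, 1]` in which uniform approximation is approximation for the enriched
structure. -/
class IsDualizing (T : UnitQuantale) (m : Prop) : Prop where
  continuous_ten : Continuous fun p : I × I => T.ten p.1 p.2
  continuous_hom : ∀ a, Continuous (T.hom a)
  exists_iterate_lt : ∀ c < 1, ∀ ε > 0, ∃ n : ℕ, (T.ten c)^[n] 1 < ε
  exists_range : ∃ r : I,
    (∀ δ < 1, ∃ ε : ℝ, 0 < ε ∧ ∀ a b : I, r ≤ a → r ≤ b → (a : ℝ) ≤ b + ε → T.ten a δ ≤ b) ∧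
    (r = 0 ∨ m ∧ ∃ F : I → I, Continuous F ∧ Monotone F ∧ (∀ a, r ≤ F a) ∧
      ∀ a, T.hom r (truncSub (F a) r) = a)

theorem continuous_truncSub (a : I) : Continuous fun b => truncSub b a := by
  unfold truncSub; fun_prop

theorem truncSub_mono (a : I) : Monotone fun b => truncSub b a := fun b c h => by
  have h' : (b : ℝ) ≤ c := h
  exact Subtype.mk_le_mk.2 (max_le_max (by linarith) le_rfl)

theorem mulQuantale_hom_coe {a : I} (ha : a ≠ 0) (b : I) :
    (mulQuantale.hom a b : ℝ) = min 1 ((b : ℝ) / a) := by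
  have ha' : (0 : ℝ) < a := lt_of_le_of_ne a.2.1 fun h => ha (Subtype.ext h.symm)
  have h0 : (0 : ℝ) ≤ min 1 ((b : ℝ) / a) := le_min zero_le_one (div_nonneg b.2.1 ha'.le)
  have : mulQuantale.hom a b = ⟨min 1 ((b : ℝ) / a), h0, min_le_left _ _⟩ := by
    refine eq_of_forall_le_iff fun c => ?_
    rw [UnitQuantale.le_hom_iff]
    change (a : ℝ) * c ≤ b ↔ (c : ℝ) ≤ min 1 ((b : ℝ) / a)
    rw [le_min_iff, le_div_iff₀ ha', mul_comm]
    exact ⟨fun h => ⟨c.2.2, h⟩, fun h => h.2⟩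
  rw [this]

theorem UnitQuantale.zero_hom (T : UnitQuantale) (b : I) : T.hom 0 b = 1 :=
  le_antisymm (T.hom 0 b).2.2 (T.one_le_hom_iff.2 zero_le)

theorem lukQuantale_hom_coe (a b : I) : (lukQuantale.hom a b : ℝ) = min 1 (1 - (a : ℝ) + b) := by
  have h0 : (0 : ℝ) ≤ min 1 (1 - (a : ℝ) + b) := le_min zero_le_one (by linarith [a.2.2, b.2.1])
  have : lukQuantale.hom a b = ⟨min 1 (1 - (a : ℝ) + b), h0, min_le_left _ _⟩ := by
    refine eq_of_forall_le_iff fun c => ?_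
    rw [UnitQuantale.le_hom_iff]
    change max 0 ((a : ℝ) + c - 1) ≤ b ↔ (c : ℝ) ≤ min 1 (1 - (a : ℝ) + b)
    rw [le_min_iff, max_le_iff]
    exact ⟨fun h => ⟨c.2.2, by linarith [h.2]⟩, fun h => ⟨b.2.1, by linarith [h.2]⟩⟩
  rw [this]

theorem lukQuantale_iterate_coe (c : I) (n : ℕ) :
    (((lukQuantale.ten c)^[n] 1 : I) : ℝ) = max 0 (1 - (n : ℝ) * (1 - c)) := by
  induction n with
  | zero => simp
  | succ n ih =>
    rw [Function.iterate_succ_apply']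
    change max 0 ((c : ℝ) + ((lukQuantale.ten c)^[n] 1 : I) - 1) = _
    rw [ih]
    push_cast
    have hc := c.2.2
    rcases max_cases (0 : ℝ) (1 - n * (1 - c)) with h | h <;> rw [h.1]
    · rw [max_eq_left (by linarith), max_eq_left (by linarith)]
    · congr 1; ring

instance : IsDualizing lukQuantale False where
  continuous_ten := by
    change Continuous fun p : I × I => luk p.1 p.2
    unfold luk; fun_prop
  continuous_hom a := by
    rw [continuous_induced_rng]
    have : (Subtype.val ∘ lukQuantale.hom a) = fun b : I => min 1 (1 - (a : ℝ) + b) :=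
      funext fun b => lukQuantale_hom_coe a b
    rw [this]; fun_prop
  exists_iterate_lt c hc ε hε := by
    have hc' : (0 : ℝ) < 1 - c := by
      have : (c : ℝ) < 1 := hc
      linarith
    obtain ⟨n, hn⟩ := exists_nat_gt (1 / (1 - (c : ℝ)))
    refine ⟨n, ?_⟩
    rw [div_lt_iff₀ hc'] at hn
    change (((lukQuantale.ten c)^[n] 1 : I) : ℝ) < ε
    rw [lukQuantale_iterate_coe, max_eq_left (by linarith)]
    exact hε
  -- Here `hom a b` is `min 1 (1 - a + b)`, so uniform and enriched approximation agree on all of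
  -- `[0,1]`.
  exists_range := ⟨0, fun δ hδ => by
    have hδ' : (δ : ℝ) < 1 := hδ
    refine ⟨1 - δ, by linarith, fun a b _ _ h => ?_⟩
    change max 0 ((a : ℝ) + δ - 1) ≤ b
    exact max_le b.2.1 (by linarith), Or.inl rfl⟩

theorem mulQuantale_iterate (c : I) (n : ℕ) : (mulQuantale.ten c)^[n] 1 = c ^ n := by
  induction n with
  | zero => simp
  | succ n ih => rw [Function.iterate_succ_apply', ih, pow_succ']; rfl

instance : IsDualizing mulQuantale True where
  continuous_ten := continuous_mul
  continuous_hom a := by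
    by_cases ha : a = 0
    · subst ha
      have : mulQuantale.hom 0 = fun _ => 1 := funext fun b => mulQuantale.zero_hom b
      rw [this]; fun_prop
    · rw [continuous_induced_rng]
      have : (Subtype.val ∘ mulQuantale.hom a) = fun b : I => min 1 ((b : ℝ) / a) :=
        funext fun b => mulQuantale_hom_coe ha b
      rw [this]; fun_prop
  exists_iterate_lt c hc ε hε := by
    obtain ⟨n, hn⟩ := exists_pow_lt_of_lt_one (show (0 : ℝ) < ε from hε) (show (c : ℝ) < 1 from hc)
    refine ⟨n, ?_⟩
    rw [mulQuantale_iterate]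
    exact hn
  exists_range := by
    -- For `a ≥ 1/2` the gap `a - a * δ` is at least `(1 - δ) / 2`, which is the `ε` chosen below.
    refine ⟨⟨1 / 2, by norm_num, by norm_num⟩, fun δ hδ => ?_, Or.inr ⟨trivial, ?_⟩⟩
    · have hδ' : (δ : ℝ) < 1 := hδ
      refine ⟨(1 - δ) / 2, by linarith, fun a b ha hb h => ?_⟩
      have ha' : (1 / 2 : ℝ) ≤ a := ha
      change (a : ℝ) * δ ≤ b
      nlinarith
    -- Subtracting `1/2` from `(1 + a) / 2` leaves `a / 2`, and the `1/2`-power divides by `1/2`.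
    · refine ⟨fun a => ⟨(1 + a) / 2, by linarith [a.2.1], by linarith [a.2.2]⟩,
        by fun_prop, fun a b h => ?_, fun a => ?_, fun a => ?_⟩
      · have h' : (a : ℝ) ≤ b := h
        exact Subtype.mk_le_mk.2 (by linarith)
      · exact Subtype.mk_le_mk.2 (by linarith [a.2.1])
      · ext
        rw [mulQuantale_hom_coe (by
          intro h
          have := congrArg Subtype.val h
          norm_num at this)]
        have h1 : (0 : ℝ) ≤ a := a.2.1
        have h2 : (a : ℝ) ≤ 1 := a.2.2
        simp only [truncSub]
        rw [max_eq_left (by linarith), min_eq_right (by linarith)]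
        ring

/-! ### Generalities on categories enriched in the unit interval -/

section VCat

variable {T : UnitQuantale} {X : Type u} {Y : Type v} [VCat T X] [VCat T Y]

theorem dist_self (x : X) : dist T x x = 1 := le_antisymm (dist T x x).2.2 (VCat.one_le' x)

theorem dist_trans (x y z : X) : T.ten (dist T x y) (dist T y z) ≤ dist T x z :=
  VCat.trans' x y z

theorem Separated.eq_of_dist_left (hX : Separated T X) {p q : X}
    (h : ∀ x, dist T p x = dist T q x) : p = q :=
  hX p q (by rw [NatLE, h, dist_self]) (by rw [NatLE, ← h, dist_self])

theorem Separated.eq_of_dist_right (hX : Separated T X) {p q : X}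
    (h : ∀ x, dist T x p = dist T x q) : p = q :=
  hX p q (by rw [NatLE, ← h, dist_self]) (by rw [NatLE, h, dist_self])

theorem IsColimit.unique (hX : Separated T X) {A : Type w} {h : A → X} {ψ : A → I} {p q : X}
    (hp : IsColimit T h ψ p) (hq : IsColimit T h ψ q) : p = q :=
  hX.eq_of_dist_left fun x => (hp x).trans (hq x).symm

theorem IsPower.unique (hX : Separated T X) {x : X} {a : I} {p q : X}
    (hp : IsPower T x a p) (hq : IsPower T x a q) : p = q :=
  hX.eq_of_dist_right fun x => (hp x).trans (hq x).symm

theorem IsVFunctor.natLE {f : X → Y} (hf : IsVFunctor T f) {x y : X} (h : NatLE T x y) :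
    NatLE T (f x) (f y) := le_trans h (hf x y)

/-- `p` is the tensor of `x` with `a`. -/
def IsTensor (x : X) (a : I) (p : X) : Prop := ∀ y, dist T p y = T.hom a (dist T x y)

/-- `p` is the binary join of `x` and `x'`. -/
def IsJoin (x x' p : X) : Prop := ∀ y, dist T p y = dist T x y ⊓ dist T x' y

/-- `p` is the bottom element. -/
def IsBottom (p : X) : Prop := ∀ y, dist T p y = 1

variable (T) in
/-- The one-element enriched category. -/
abbrev unitVCat : VCat T Unit where
  dist' _ _ := 1
  one_le' _ := le_rfl
  trans' _ _ _ := T.ten_le_left _ _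

variable (T) in
/-- A discrete enriched category. -/
noncomputable abbrev discreteVCat (A : Type w) [DecidableEq A] : VCat T A where
  dist' x y := if x = y then 1 else 0
  one_le' x := by simp
  trans' x y z := by
    by_cases h : x = y
    · subst h
      simp [T.one_ten]
    · simp [h, T.zero_ten]

/-! ### Tensors as colimits over the one-point category -/

section

attribute [local instance] unitVCat

theorem isColimit_unit_iff {x p : X} {a : I} :
    IsColimit T (fun _ : Unit => x) (fun _ => a) p ↔ IsTensor (T := T) x a p := by
  simp only [IsColimit, IsTensor, ciInf_unique]

theorem isWeight_unit (a : I) : IsWeight T (fun _ : Unit => a) := fun _ _ =>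
  T.ten_le_right _ _

theorem isVFunctor_unit (x : X) : IsVFunctor T (fun _ : Unit => x) := fun _ _ => by
  rw [dist_self, dist_self]

theorem FinitelyCocomplete.exists_isTensor (hX : FinitelyCocomplete T X) (x : X) (a : I) :
    ∃ p : X, IsTensor (T := T) x a p := by
  obtain ⟨p, hp⟩ := hX Unit (fun _ => x) (fun _ => a) (isVFunctor_unit x) (isWeight_unit a)
  exact ⟨p, isColimit_unit_iff.1 hp⟩

theorem IsFinCocontinuous.map_isTensor {f : X → Y} (hf : IsFinCocontinuous T f) {x p : X} {a : I}
    (hp : IsTensor (T := T) x a p) : IsTensor (T := T) (f x) a (f p) :=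
  isColimit_unit_iff.1 (hf.preserves Unit (fun _ => x) (fun _ => a) (isVFunctor_unit x)
    (isWeight_unit a) p (isColimit_unit_iff.2 hp))

end

/-! ### Joins and bottom as colimits over discrete categories -/

section

attribute [local instance] discreteVCat

theorem isVFunctor_discrete {A : Type w} [DecidableEq A] (h : A → X) : IsVFunctor T h := by
  intro x y
  by_cases hxy : x = y
  · subst hxy
    rw [dist_self, dist_self]
  · have : dist T x y = 0 := if_neg hxy
    rw [this]
    exact zero_le

theorem isWeight_discrete {A : Type w} [DecidableEq A] (ψ : A → I) : IsWeight T ψ := by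
  intro x y
  by_cases hxy : x = y
  · subst hxy
    exact T.ten_le_right _ _
  · have : dist T x y = 0 := if_neg hxy
    rw [this, T.zero_ten]
    exact zero_le

theorem one_hom (T : UnitQuantale) (a : I) : T.hom 1 a = a :=
  eq_of_forall_le_iff fun c => by rw [T.le_hom_iff, T.one_ten]

theorem isColimit_bool_iff {x x' p : X} :
    IsColimit T (fun b : Bool => if b then x else x') (fun _ => 1) p ↔
      IsJoin (T := T) x x' p := by
  simp only [IsColimit, IsJoin, iInf_bool_eq, one_hom, if_true, Bool.false_eq_true, if_false]

theorem isColimit_empty_iff {p : X} {ψ : Empty → I} :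
    IsColimit T (fun e : Empty => e.elim) ψ p ↔ IsBottom (T := T) p := by
  simp only [IsColimit, IsBottom, iInf_of_empty]
  rfl

theorem FinitelyCocomplete.exists_isJoin (hX : FinitelyCocomplete T X) (x x' : X) :
    ∃ p : X, IsJoin (T := T) x x' p := by
  obtain ⟨p, hp⟩ := hX Bool (fun b => if b then x else x') (fun _ => 1) (isVFunctor_discrete _)
    (isWeight_discrete _)
  exact ⟨p, isColimit_bool_iff.1 hp⟩

theorem FinitelyCocomplete.exists_isBottom (hX : FinitelyCocomplete T X) :
    ∃ p : X, IsBottom (T := T) p := by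
  obtain ⟨p, hp⟩ := hX Empty (fun e => e.elim) (fun _ => 1) (isVFunctor_discrete _)
    (isWeight_discrete _)
  exact ⟨p, isColimit_empty_iff.1 hp⟩

theorem IsFinCocontinuous.map_isJoin {f : X → Y} (hf : IsFinCocontinuous T f) {x x' p : X}
    (hp : IsJoin (T := T) x x' p) : IsJoin (T := T) (f x) (f x') (f p) := by
  have h := hf.preserves Bool (fun b => if b then x else x') (fun _ => 1) (isVFunctor_discrete _)
    (isWeight_discrete _) p (isColimit_bool_iff.2 hp)
  rw [← isColimit_bool_iff]
  convert h using 2 with b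
  cases b <;> rfl

theorem IsFinCocontinuous.map_isBottom {f : X → Y} (hf : IsFinCocontinuous T f) {p : X}
    (hp : IsBottom (T := T) p) : IsBottom (T := T) (f p) := by
  have h := hf.preserves Empty (fun e => e.elim) (fun _ => 1) (isVFunctor_discrete _)
    (isWeight_discrete _) p (isColimit_empty_iff.2 hp)
  rw [← isColimit_empty_iff (ψ := fun _ => 1)]
  convert h using 2 with e

end

theorem IsJoin.unique (hX : Separated T X) {x x' p q : X}
    (hp : IsJoin (T := T) x x' p) (hq : IsJoin (T := T) x x' q) : p = q :=
  hX.eq_of_dist_left fun x => (hp x).trans (hq x).symm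

theorem IsTensor.unique (hX : Separated T X) {x : X} {a : I} {p q : X}
    (hp : IsTensor (T := T) x a p) (hq : IsTensor (T := T) x a q) : p = q :=
  hX.eq_of_dist_left fun x => (hp x).trans (hq x).symm

theorem IsBottom.unique (hX : Separated T X) {p q : X}
    (hp : IsBottom (T := T) p) (hq : IsBottom (T := T) q) : p = q :=
  hX.eq_of_dist_left fun x => (hp x).trans (hq x).symm

end VCat

section Unit

variable {T : UnitQuantale}

theorem unit_dist (a b : I) : dist T a b = T.hom a b := rfl

theorem unit_natLE {a b : I} : NatLE T a b ↔ a ≤ b := T.one_le_hom_iff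

theorem unit_isTensor (a b : I) : IsTensor (T := T) b a (T.ten a b) := fun c =>
  eq_of_forall_le_iff fun d => by
    simp only [unit_dist, T.le_hom_iff, ← T.ten_assoc, T.ten_comm a b]

theorem sup_hom (T : UnitQuantale) (a b c : I) : T.hom (a ⊔ b) c = T.hom a c ⊓ T.hom b c :=
  eq_of_forall_le_iff fun d => by
    rw [T.le_hom_iff, le_inf_iff, T.le_hom_iff, T.le_hom_iff, T.ten_comm, T.ten_sup, sup_le_iff,
      T.ten_comm d, T.ten_comm d]

theorem unit_isJoin (a b : I) : IsJoin (T := T) a b (a ⊔ b) := fun c => sup_hom T a b c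

theorem unit_isBottom : IsBottom (T := T) (0 : I) := fun c => T.zero_hom c

theorem unit_isPower (a b : I) : IsPower T b a (T.hom a b) := fun c => T.hom_comm c a b

theorem unit_isPower_iff {a b p : I} : IsPower T b a p ↔ p = T.hom a b :=
  ⟨fun h => h.unique (unit_separated T) (unit_isPower a b), fun h => h ▸ unit_isPower a b⟩

variable {X : Type u} [VCat T X] {f : X → I}

theorem IsVFunctor.mono {f : X → I} (hf : IsVFunctor T f) {x y : X} (h : NatLE T x y) :
    f x ≤ f y := unit_natLE.1 (hf.natLE h)

theorem IsFinCocontinuous.map_tensor (hf : IsFinCocontinuous T f) {x p : X} {a : I}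
    (hp : IsTensor (T := T) x a p) : f p = T.ten a (f x) :=
  (hf.map_isTensor hp).unique (unit_separated T) (unit_isTensor a (f x))

theorem IsFinCocontinuous.map_join (hf : IsFinCocontinuous T f) {x x' p : X}
    (hp : IsJoin (T := T) x x' p) : f p = f x ⊔ f x' :=
  (hf.map_isJoin hp).unique (unit_separated T) (unit_isJoin _ _)

theorem IsFinCocontinuous.map_bottom (hf : IsFinCocontinuous T f) {p : X}
    (hp : IsBottom (T := T) p) : f p = 0 :=
  (hf.map_isBottom hp).unique (unit_separated T) unit_isBottom

/-- Suprema commute with each other and with the tensor. Inverse image along a distributor is a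
supremum of evaluations, so this gives its cocontinuity. -/
theorem IsFinCocontinuous.iSup {ι : Sort*} {F : ι → X → I} (hF : ∀ i, IsFinCocontinuous T (F i)) :
    IsFinCocontinuous T (fun x => ⨆ i, F i x) where
  isVFunctor x y := T.le_hom_iff.2 (by
    beta_reduce
    rw [T.ten_comm, ← sSup_range, T.ten_sSup, ← Set.range_comp, sSup_range]
    refine iSup_mono fun i => ?_
    rw [Function.comp_apply, T.ten_comm, ← T.le_hom_iff]
    exact (hF i).isVFunctor x y)
  preserves A _ _ h ψ hh hψ x₀ hx := by
    have e : (⨆ i, F i x₀) = ⨆ z, T.ten (⨆ i, F i (h z)) (ψ z) := by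
      simp only [fun i => unit_isColimit_unique T ((hF i).preserves A h ψ hh hψ x₀ hx)]
      rw [iSup_comm]
      refine iSup_congr fun z => ?_
      rw [T.ten_comm, ← sSup_range, ← sSup_range, T.ten_sSup, ← Set.range_comp]
      simp only [Function.comp_def, T.ten_comm (ψ z)]
    rw [e]
    exact unit_isColimit T (fun z => ⨆ i, F i (h z)) ψ

end Unit

section Monoid

variable {T : UnitQuantale} {m : Prop} {X : Type u} {Y : Type v} [CoctsMonoid T m X]
  [CoctsMonoid T m Y]

theorem IsPowHom.isLaxHom {f : X → Y} (hf : IsPowHom T m f) : IsLaxHom T m f :=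
  ⟨hf.cocontinuous, fun x y => by rw [NatLE, hf.map_mul, dist_self]⟩

variable {e : X → Y} {g : Y → X}

theorem IsColimit.of_inverse (he : ∀ x x', dist T (e x) (e x') = dist T x x')
    (hge : ∀ y, e (g y) = y) {A : Type w} {h : A → Y} {ψ : A → I} {y : Y}
    (hy : IsColimit T h ψ y) : IsColimit T (g ∘ h) ψ (g y) := fun x => by
  rw [← he, hge, hy]
  simp only [Function.comp_apply, ← he, hge]

/-- The inverse of a bijective isometric morphism is a morphism. -/
theorem IsPowHom.inverse (h : IsPowHom T m e) (he : ∀ x x', dist T (e x) (e x') = dist T x x')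
    (hge : ∀ y, e (g y) = y) (heg : ∀ x, g (e x) = x) : IsPowHom T m g where
  cocontinuous :=
    ⟨fun x y => by rw [← he, hge, hge], fun _ _ _ _ _ _ _ _ hy => hy.of_inverse he hge⟩
  map_mul x y := by
    conv_lhs => rw [← hge x, ← hge y, ← h.map_mul, heg]
  map_one := by rw [← h.map_one, heg]
  map_power x a p hp y := by
    rw [← he, hge, hp, ← he, hge]
  map_minus hm x a := by
    conv_lhs => rw [← hge x, ← h.map_minus, heg]

end Monoid

/-! ### The object of antitone continuous functions -/

/-- Antitone continuous functions into the unit interval. -/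
@[ext]
structure AntiMap (X : Type u) [TopologicalSpace X] [PartialOrder X] where
  toFun : X → I
  continuous_toFun : Continuous toFun
  antitone_toFun : Antitone toFun

namespace AntiMap

section Basic

variable {X : Type u} {Y : Type v} [TopologicalSpace X] [PartialOrder X] [TopologicalSpace Y]
  [PartialOrder Y]

instance : FunLike (AntiMap X) X I where
  coe := toFun
  coe_injective _ _ h := AntiMap.ext h

theorem continuous (f : AntiMap X) : Continuous f := f.continuous_toFun

theorem antitone (f : AntiMap X) : Antitone f := f.antitone_toFun

theorem ext' {f g : AntiMap X} (h : ∀ x, f x = g x) : f = g := DFunLike.ext _ _ h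

/-- The constant function. -/
def const (X : Type u) [TopologicalSpace X] [PartialOrder X] (a : I) : AntiMap X :=
  ⟨fun _ => a, continuous_const, antitone_const⟩

@[simp]
theorem const_apply (a : I) (x : X) : const X a x = a := rfl

/-- Postcomposition with a monotone continuous function. -/
def map (F : I → I) (hF : Continuous F) (hF' : Monotone F) (f : AntiMap X) : AntiMap X :=
  ⟨fun x => F (f x), hF.comp f.continuous, hF'.comp_antitone f.antitone⟩

/-- The pointwise maximum. -/
def sup (f g : AntiMap X) : AntiMap X :=
  ⟨fun x => f x ⊔ g x, f.continuous.sup g.continuous, f.antitone.sup g.antitone⟩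

@[simp]
theorem sup_apply (f g : AntiMap X) (x : X) : sup f g x = f x ⊔ g x := rfl

/-- Precomposition with a monotone continuous function. -/
def comp (f : AntiMap Y) (g : X →Co Y) : AntiMap X :=
  ⟨fun x => f (g x), f.continuous.comp g.continuous_toFun, f.antitone.comp_monotone g.monotone'⟩

@[simp]
theorem comp_apply (f : AntiMap Y) (g : X →Co Y) (x : X) : comp f g x = f (g x) := rfl

end Basic

section VCat

variable {T : UnitQuantale} {X : Type u} [TopologicalSpace X] [PartialOrder X]

noncomputable instance : VCat T (AntiMap X) where
  dist' f g := ⨅ x, T.hom (f x) (g x)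
  one_le' _ := le_iInf fun _ => T.one_le_hom_iff.2 le_rfl
  trans' f g h := le_iInf fun x => (T.ten_mono (iInf_le _ x) (iInf_le _ x)).trans
    (dist_trans (T := T) (f x) (g x) (h x))

theorem dist_def (f g : AntiMap X) : dist T f g = ⨅ x, T.hom (f x) (g x) := rfl

theorem le_dist_iff {f g : AntiMap X} {a : I} : a ≤ dist T f g ↔ ∀ x, T.ten (f x) a ≤ g x := by
  simp only [dist_def, le_iInf_iff, T.le_hom_iff]

theorem natLE_iff {f g : AntiMap X} : NatLE T f g ↔ ∀ x, f x ≤ g x := by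
  simp only [NatLE, le_dist_iff, T.ten_one]

theorem separated : Separated T (AntiMap X) := fun _ _ h h' =>
  ext' fun x => le_antisymm (natLE_iff.1 h x) (natLE_iff.1 h' x)

theorem isColimit_of_apply {A : Type w} {h : A → AntiMap X} {ψ : A → I} {f : AntiMap X}
    (hf : ∀ x, f x = ⨆ z, T.ten (h z x) (ψ z)) : IsColimit T h ψ f := fun g => by
  have key : ∀ x, T.hom (f x) (g x) = ⨅ z, T.hom (ψ z) (T.hom (h z x) (g x)) := fun x => by
    rw [hf]
    exact unit_isColimit T (fun z => h z x) ψ (g x)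
  simp only [dist_def, key, T.hom_iInf]
  exact iInf_comm

theorem isPower_of_apply {f p : AntiMap X} {a : I} (hp : ∀ x, p x = T.hom a (f x)) :
    IsPower T f a p := fun g => by
  simp only [dist_def, hp, T.hom_iInf]
  exact iInf_congr fun x => T.hom_comm _ _ _

theorem isTensor_of_apply {f p : AntiMap X} {a : I} (hp : ∀ x, p x = T.ten a (f x)) :
    IsTensor (T := T) f a p := fun g => by
  simp only [dist_def, hp, T.hom_iInf]
  exact iInf_congr fun x => unit_isTensor a (f x) (g x)

theorem isJoin_sup (f g : AntiMap X) : IsJoin (T := T) f g (sup f g) := fun k => by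
  simp only [dist_def, sup_apply, sup_hom, iInf_inf_eq]

theorem isBottom_const : IsBottom (T := T) (const X 0) := fun k => by
  simp only [dist_def, const_apply, T.zero_hom]
  exact iInf_top

theorem isFinCocontinuous_of_apply {P : Type v} [VCat T P] {F : P → AntiMap X}
    (hF : ∀ x, IsFinCocontinuous T fun p => F p x) : IsFinCocontinuous T F where
  isVFunctor p q := le_iInf fun x => (hF x).isVFunctor p q
  preserves A _ _ h ψ hh hψ x₀ hx := isColimit_of_apply fun x =>
    unit_isColimit_unique T ((hF x).preserves A h ψ hh hψ x₀ hx)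

end VCat

section Operations

variable {T : UnitQuantale} {m : Prop} {X : Type u} [TopologicalSpace X] [PartialOrder X]

variable (T m) in
/-- The pointwise tensor. -/
def ten [hT : IsDualizing T m] (f g : AntiMap X) : AntiMap X :=
  ⟨fun x => T.ten (f x) (g x), hT.continuous_ten.comp (f.continuous.prodMk g.continuous),
    fun _ _ h => T.ten_mono (f.antitone h) (g.antitone h)⟩

@[simp]
theorem ten_apply [IsDualizing T m] (f g : AntiMap X) (x : X) :
    ten T m f g x = T.ten (f x) (g x) := rfl

variable (T m) in
/-- The pointwise power. -/
noncomputable def pow [hT : IsDualizing T m] (f : AntiMap X) (a : I) : AntiMap X :=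
  map (T.hom a) (hT.continuous_hom a) (fun _ _ h => T.hom_mono_right a h) f

@[simp]
theorem pow_apply [IsDualizing T m] (f : AntiMap X) (a : I) (x : X) :
    pow T m f a x = T.hom a (f x) := rfl

theorem isPower_iff {f p : AntiMap X} {a : I} (hT : IsDualizing T m) :
    IsPower T f a p ↔ ∀ x, p x = T.hom a (f x) := by
  refine ⟨fun h x => ?_, isPower_of_apply⟩
  rw [h.unique separated (isPower_of_apply (p := pow T m f a) fun _ => rfl), pow_apply]

/-- The pointwise colimit, for a finite diagram. -/
theorem exists_apply_eq_iSup (hT : IsDualizing T m) {A : Type w} [Finite A] (h : A → AntiMap X)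
    (ψ : A → I) : ∃ f : AntiMap X, ∀ x, f x = ⨆ z, T.ten (h z x) (ψ z) := by
  have := Fintype.ofFinite A
  refine ⟨⟨fun x => ⨆ z, T.ten (h z x) (ψ z), ?_, fun x y hxy =>
    iSup_mono fun z => T.ten_mono ((h z).antitone hxy) le_rfl⟩, fun _ => rfl⟩
  simp only [← Finset.sup_univ_eq_iSup]
  exact Continuous.finset_sup_apply fun z _ =>
    hT.continuous_ten.comp ((h z).continuous.prodMk continuous_const)

/-- A finite pointwise colimit is still continuous, so by separatedness it is the colimit. -/
theorem isFinCocontinuous_eval (hT : IsDualizing T m) (x : X) :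
    IsFinCocontinuous T fun f : AntiMap X => f x where
  isVFunctor _ _ := iInf_le _ x
  preserves A _ _ h ψ _ _ x₀ hx := by
    obtain ⟨f, hf⟩ := exists_apply_eq_iSup hT h ψ
    rw [hx.unique separated (isColimit_of_apply hf), hf]
    exact unit_isColimit T (fun z => h z x) ψ

theorem powered (hT : IsDualizing T m) : Powered T (AntiMap X) := fun f a =>
  ⟨pow T m f a, isPower_of_apply fun _ => rfl⟩

/-- The pointwise colimit is a supremum of continuous functions, hence lower semicontinuous. The
adjunction between `φ` and `ψ` rewrites it as the infimum of `hom (φ z) (h z x)`, hence it is also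
upper semicontinuous. -/
theorem cauchyComplete (hT : IsDualizing T m) : CauchyComplete T (AntiMap X) := by
  rintro A _ h ψ hh hψ ⟨φ, hφ, hφψ, hψφ⟩
  have hle : ∀ x z z', T.ten (φ z') (T.ten (h z x) (ψ z)) ≤ h z' x := fun x z z' => by
    rw [T.ten_comm, T.ten_assoc]
    refine (T.ten_mono_right _ ((hψφ z z').trans (hh z z'))).trans ?_
    exact (T.ten_mono_right _ (iInf_le _ x)).trans (T.ten_hom_le _ _)
  have key : ∀ x, ⨆ z, T.ten (h z x) (ψ z) = ⨅ z, T.hom (φ z) (h z x) := fun x => by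
    refine le_antisymm (iSup_le fun z => le_iInf fun z' => T.le_hom_iff.2 (hle x z z')) ?_
    refine (T.one_ten (⨅ z, T.hom (φ z) (h z x))).symm.le.trans ?_
    refine (T.ten_mono hφψ le_rfl).trans ?_
    rw [T.iSup_ten]
    refine iSup_mono fun z => ?_
    rw [T.ten_comm (φ z), T.ten_assoc, T.ten_comm]
    exact T.ten_mono ((T.ten_mono_right _ (iInf_le _ z)).trans (T.ten_hom_le _ _)) le_rfl
  refine ⟨⟨fun x => ⨆ z, T.ten (h z x) (ψ z), continuous_iff_lower_upperSemicontinuous.2 ⟨?_, ?_⟩,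
    fun x y hxy => iSup_mono fun z => T.ten_mono ((h z).antitone hxy) le_rfl⟩,
    isColimit_of_apply fun _ => rfl⟩
  · exact lowerSemicontinuous_iSup fun z => (hT.continuous_ten.comp
      ((h z).continuous.prodMk continuous_const)).lowerSemicontinuous
  · simp only [key]
    exact upperSemicontinuous_iInf fun z =>
      ((hT.continuous_hom _).comp (h z).continuous).upperSemicontinuous

end Operations

section CoctsMonoid

variable {T : UnitQuantale} {m : Prop} [hT : IsDualizing T m] {X : Type u} {Y : Type v}
  [TopologicalSpace X] [PartialOrder X] [TopologicalSpace Y] [PartialOrder Y]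

noncomputable instance : CoctsMonoid T m (AntiMap X) where
  separated := separated
  finitelyCocomplete _ _ _ h ψ _ _ :=
    let ⟨f, hf⟩ := exists_apply_eq_iSup hT h ψ
    ⟨f, isColimit_of_apply hf⟩
  mul' := ten T m
  one' := const X 1
  mul_comm' _ _ := ext' fun _ => T.ten_comm _ _
  mul_assoc' _ _ _ := ext' fun _ => T.ten_assoc _ _ _
  mul_one' _ := ext' fun _ => T.ten_one _
  le_one' f := natLE_iff.2 fun x => (f x).2.2
  mul_cocontinuous' f := isFinCocontinuous_of_apply fun x =>
    (unit_ten_cocontinuous T (f x)).comp (isFinCocontinuous_eval hT x)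
  minus' _ f a := map (fun b => truncSub b a) (continuous_truncSub a) (truncSub_mono a) f

theorem cminus_apply (hm : m) (f : AntiMap X) (a : I) (x : X) :
    cminus T m hm f a x = truncSub (f x) a := rfl

theorem isPowHom_eval (x : X) : IsPowHom T m fun f : AntiMap X => f x where
  cocontinuous := isFinCocontinuous_eval hT x
  map_mul _ _ := rfl
  map_one := rfl
  map_power _ _ _ hp := unit_isPower_iff.2 ((isPower_iff hT).1 hp x)
  map_minus _ _ _ := rfl

theorem isPowHom_of_apply {P : Type v} [CoctsMonoid T m P] {F : P → AntiMap X}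
    (hF : ∀ x, IsPowHom T m fun p => F p x) : IsPowHom T m F where
  cocontinuous := isFinCocontinuous_of_apply fun x => (hF x).cocontinuous
  map_mul p q := ext' fun x => (hF x).map_mul p q
  map_one := ext' fun x => (hF x).map_one
  map_power p a q hq := isPower_of_apply fun x => unit_isPower_iff.1 ((hF x).map_power p a q hq)
  map_minus hm p a := ext' fun x => (hF x).map_minus hm p a

theorem isPowHom_comp (g : X →Co Y) : IsPowHom T m fun f : AntiMap Y => comp f g :=
  isPowHom_of_apply fun x => isPowHom_eval (g x)

theorem hasEnoughCharacters :
    ACat.HasEnoughCharacters (⟨AntiMap X, powered hT⟩ : ACat T m) := fun _ _ h =>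
  ext' fun x => h _ (isPowHom_eval x)

end CoctsMonoid

section Distributor

variable {T : UnitQuantale} {m : Prop} [hT : IsDualizing T m] {X : Type u} {Y : Type v}
  {Z : Type w} [TopologicalSpace X] [PartialOrder X] [TopologicalSpace Y] [PartialOrder Y]
  [TopologicalSpace Z] [PartialOrder Z]

/-- Inverse image along a continuous distributor. -/
noncomputable def pull [CompactSpace Y] (φ : ContDist X Y) (f : AntiMap Y) : AntiMap X where
  toFun x := ⨆ y : {y // φ.Rel x y}, f y
  continuous_toFun := by
    -- Since `f` is antitone, `{f > a}` is an open lower set and `{f ≥ a}` a closed lower set; the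
    -- Vietoris topology controls when `φ x` meets either.
    refine continuous_iff_lower_upperSemicontinuous.2
      ⟨lowerSemicontinuous_iff_isOpen_preimage.2 fun a => ?_,
        upperSemicontinuous_iff_isClosed_preimage.2 fun a => ?_⟩
    · convert φ.isOpen_hit (isOpen_Ioi.preimage f.continuous : IsOpen (f ⁻¹' Ioi a))
        (fun y y' h hy => lt_of_lt_of_le hy (f.antitone h)) using 1
      ext x
      simp only [mem_preimage, mem_Ioi, lt_iSup_iff, Subtype.exists, exists_prop, mem_ofPred_eq,
        and_comm]
    -- If `φ x` is empty the supremum is `0`, which is `≥ a` exactly for `a = 0` although nothing is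
    -- hit.
    · by_cases ha : a = 0
      · subst ha
        convert isClosed_univ
        exact eq_univ_of_forall fun x => (zero_le : (0 : I) ≤ _)
      convert φ.isClosed_hit (isClosed_Ici.preimage f.continuous : IsClosed (f ⁻¹' Ici a))
        (fun y y' h hy => le_trans hy (f.antitone h)) using 1
      ext x
      simp only [mem_preimage, mem_Ici, mem_ofPred_eq]
      constructor
      · intro h
        have hne : {y | φ.Rel x y}.Nonempty := by
          by_contra hne
          have : IsEmpty {y // φ.Rel x y} := ⟨fun y => hne ⟨y.1, y.2⟩⟩
          rw [iSup_of_empty] at h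
          exact ha (le_bot_iff.1 h)
        obtain ⟨y, hy, hmax⟩ := ((φ x).isClosed.isCompact).exists_isMaxOn hne
          f.continuous.continuousOn
        exact ⟨y, h.trans (iSup_le fun y' => hmax y'.2), hy⟩
      · rintro ⟨y, hy, hxy⟩
        exact le_iSup_of_le (⟨y, hxy⟩ : {y // φ.Rel x y}) hy
  antitone_toFun x x' h := iSup_le fun y =>
    le_iSup_of_le (⟨y.1, φ.rel_of_le h le_rfl y.2⟩ : {y // φ.Rel x y}) le_rfl

/-- Multiplication is preserved only laxly, since the suprema of `f` and `g` may be attained at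
different points. -/
theorem isLaxHom_pull [CompactSpace Y] (φ : ContDist X Y) : IsLaxHom T m (pull φ) where
  cocontinuous := isFinCocontinuous_of_apply fun _ =>
    IsFinCocontinuous.iSup fun y => isFinCocontinuous_eval hT y.1
  map_mul_le f g := natLE_iff.2 fun x => iSup_le fun y =>
    T.ten_mono (le_iSup (fun y : {y // φ.Rel x y} => f y) y)
      (le_iSup (fun y : {y // φ.Rel x y} => g y) y)

theorem pull_id [CompactSpace X] [OrderClosedTopology X] (f : AntiMap X) :
    pull (ContDist.id X) f = f := ext' fun x =>
  le_antisymm (iSup_le fun y => f.antitone y.2)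
    (le_iSup_of_le (⟨x, le_refl x⟩ : {y // (ContDist.id X).Rel x y}) le_rfl)

theorem pull_comp [CompactSpace Y] [OrderClosedTopology Y] [CompactSpace Z]
    [OrderClosedTopology Z] (ψ : ContDist Y Z) (φ : ContDist X Y) (f : AntiMap Z) :
    pull (ψ.comp φ) f = pull φ (pull ψ f) := ext' fun x => by
  refine le_antisymm (iSup_le fun z => ?_) (iSup_le fun y => iSup_le fun z => ?_)
  · obtain ⟨z, y, hy, hz⟩ := z
    exact le_iSup_of_le (⟨y, hy⟩ : {y // φ.Rel x y})
      (le_iSup (fun z : {z // ψ.Rel y z} => f z) ⟨z, hz⟩)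
  · exact le_iSup_of_le (⟨z.1, y.1, y.2, z.2⟩ : {z // (ψ.comp φ).Rel x z}) le_rfl

end Distributor

/-! ### Representation of functionals by closed upper sets -/

section Representation

variable {T : UnitQuantale} {m : Prop} [hT : IsDualizing T m] {Y : Type u}
  [TopologicalSpace Y] [PartialOrder Y]

/-- The closed upper set that represents a functional. -/
def support (Φ : AntiMap Y → I) : Set Y := {y | ∀ f, f y ≤ Φ f}

theorem isClosed_support (Φ : AntiMap Y → I) : IsClosed (support Φ) := by
  simp only [support, ofPred_forall]
  exact isClosed_iInter fun f => isClosed_le f.continuous continuous_const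

theorem isUpperSet_support (Φ : AntiMap Y → I) : IsUpperSet (support Φ) :=
  fun _ _ h hy f => (f.antitone h).trans (hy f)

theorem iterate_ten_apply (f : AntiMap Y) (n : ℕ) (y : Y) :
    ((ten T m f)^[n] (const Y 1)) y = (T.ten (f y))^[n] 1 := by
  induction n with
  | zero => rfl
  | succ n ih => rw [Function.iterate_succ_apply', Function.iterate_succ_apply', ten_apply, ih]

theorem _root_.UnitDuality.UnitQuantale.iterate_ten_one (T : UnitQuantale) (n : ℕ) :
    (T.ten 1)^[n] 1 = 1 := by
  induction n with
  | zero => rfl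
  | succ n ih => rw [Function.iterate_succ_apply', ih, T.ten_one]

theorem _root_.UnitDuality.UnitQuantale.iterate_ten_mono (T : UnitQuantale) {a b : I} (h : a ≤ b)
    (n : ℕ) : (T.ten a)^[n] 1 ≤ (T.ten b)^[n] 1 := by
  induction n with
  | zero => rfl
  | succ n ih =>
    rw [Function.iterate_succ_apply', Function.iterate_succ_apply']
    exact T.ten_mono h ih

variable {Φ : AntiMap Y → I}

theorem mono_of_isFinCocontinuous (hΦ : IsFinCocontinuous T Φ) {f g : AntiMap Y}
    (h : ∀ y, f y ≤ g y) : Φ f ≤ Φ g := hΦ.isVFunctor.mono (natLE_iff.2 h)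

theorem map_iterate_le (hΦ' : ∀ f g, Φ (ten T m f g) ≤ T.ten (Φ f) (Φ g)) (f : AntiMap Y)
    (n : ℕ) : Φ ((ten T m f)^[n] (const Y 1)) ≤ (T.ten (Φ f))^[n] 1 := by
  induction n with
  | zero => exact (Φ _).2.2
  | succ n ih =>
    rw [Function.iterate_succ_apply', Function.iterate_succ_apply']
    exact (hΦ' _ _).trans (T.ten_mono_right _ ih)

/-- Powers are not assumed to be preserved, but `a ⊗ hom a f ≤ f` and preservation of tensors give
this half. -/
theorem map_pow_le (hΦ : IsFinCocontinuous T Φ) (f : AntiMap Y) (a : I) :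
    Φ (pow T m f a) ≤ T.hom a (Φ f) := by
  rw [T.le_hom_iff, ← hΦ.map_tensor
    (isTensor_of_apply (p := ten T m (const Y a) (pow T m f a)) fun _ => rfl)]
  exact mono_of_isFinCocontinuous hΦ fun y => T.ten_hom_le _ _

/-- Choose `Φ f < s < f y`. The `s`-power of `f` is `1` near `y`, while its `Φ`-value is at most
`hom s (Φ f) < 1`. Iterated tensoring keeps the value `1` and, by laxness and the Archimedean
property, makes the `Φ`-value small. -/
theorem exists_eventually_eq_one (hΦ : IsFinCocontinuous T Φ)
    (hΦ' : ∀ f g, Φ (ten T m f g) ≤ T.ten (Φ f) (Φ g)) {y : Y} (hy : y ∉ support Φ) {ε : I}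
    (hε : 0 < ε) : ∃ χ : AntiMap Y, (∀ᶠ y' in 𝓝 y, χ y' = 1) ∧ Φ χ < ε := by
  simp only [support, mem_ofPred_eq, not_forall, not_le] at hy
  obtain ⟨f, hf⟩ := hy
  obtain ⟨s, hs, hs'⟩ := exists_between hf
  obtain ⟨n, hn⟩ := hT.exists_iterate_lt (T.hom s (Φ f)) (T.hom_lt_one hs) ε hε
  refine ⟨(ten T m (pow T m f s))^[n] (const Y 1), ?_, ?_⟩
  · filter_upwards [(isOpen_Ioi.preimage f.continuous).mem_nhds hs'] with y' hy'
    have : T.hom s (f y') = 1 :=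
      le_antisymm (T.hom s (f y')).2.2 (T.one_le_hom_iff.2 (le_of_lt hy'))
    rw [iterate_ten_apply, pow_apply, this, T.iterate_ten_one]
  · exact (map_iterate_le hΦ' _ n).trans_lt
      ((T.iterate_ten_mono (map_pow_le hΦ f s) n).trans_lt hn)

/-- If `r` lies strictly between the supremum and `Φ f`, the compact set `{f ≥ r}` misses the
support. A finite join of cutoffs gives `χ` equal to `1` there with `Φ χ < Φ f`. Then `f ≤ χ ⊔ r`
forces `Φ f < Φ f`. -/
theorem eq_iSup_support [CompactSpace Y] (hΦ : IsFinCocontinuous T Φ)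
    (hΦ' : ∀ f g, Φ (ten T m f g) ≤ T.ten (Φ f) (Φ g)) (f : AntiMap Y) :
    Φ f = ⨆ y : support Φ, f y := by
  refine le_antisymm ?_ (iSup_le fun y => y.2 f)
  by_contra! h
  obtain ⟨r, hr, hr'⟩ := exists_between h
  have hK : IsCompact (f ⁻¹' Ici r) := (isClosed_Ici.preimage f.continuous).isCompact
  obtain ⟨χ, hχ, hχ'⟩ : ∃ χ : AntiMap Y, (∀ y ∈ f ⁻¹' Ici r, χ y = 1) ∧ Φ χ < Φ f := by
    refine hK.induction_on (p := fun S => ∃ χ : AntiMap Y, (∀ y ∈ S, χ y = 1) ∧ Φ χ < Φ f)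
      ⟨const Y 0, by simp, ?_⟩ ?_ ?_ ?_
    · rw [hΦ.map_bottom isBottom_const]
      exact zero_le.trans_lt hr'
    · rintro S S' hS ⟨χ, h₁, h₂⟩
      exact ⟨χ, fun y hy => h₁ y (hS hy), h₂⟩
    · rintro S S' ⟨χ, h₁, h₂⟩ ⟨χ', h₁', h₂'⟩
      refine ⟨sup χ χ', ?_, ?_⟩
      · have h1 : ∀ a : I, a ⊔ 1 = 1 ∧ 1 ⊔ a = 1 := fun a =>
          ⟨sup_eq_right.2 a.2.2, sup_eq_left.2 a.2.2⟩
        rintro y (hy | hy)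
        · rw [sup_apply, h₁ y hy, (h1 _).2]
        · rw [sup_apply, h₁' y hy, (h1 _).1]
      · rw [hΦ.map_join (isJoin_sup χ χ')]
        exact max_lt h₂ h₂'
    · intro y hy
      have hy' : y ∉ support Φ := fun hys =>
        (lt_of_lt_of_le hr hy).not_ge (le_iSup (fun y : support Φ => f y) ⟨y, hys⟩)
      obtain ⟨χ, h₁, h₂⟩ := exists_eventually_eq_one hΦ hΦ' hy' (zero_le.trans_lt hr')
      exact ⟨_, mem_nhdsWithin_of_mem_nhds h₁, χ, fun _ hz => hz, h₂⟩
  have hconst : Φ (const Y r) ≤ r := by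
    rw [hΦ.map_tensor (isTensor_of_apply (f := const Y 1) (a := r) fun _ => (T.ten_one r).symm)]
    exact T.ten_le_left _ _
  have hle : Φ f ≤ Φ χ ⊔ Φ (const Y r) := by
    rw [← hΦ.map_join (isJoin_sup χ (const Y r))]
    refine mono_of_isFinCocontinuous hΦ fun y => ?_
    rcases le_total r (f y) with hy | hy
    · exact le_sup_of_le_left (by rw [hχ y hy]; exact (f y).2.2)
    · exact le_sup_of_le_right hy
  exact (hle.trans_lt (max_lt hχ' (hconst.trans_lt hr'))).false

/-- A multiplicative functional that preserves the unit is the evaluation at a point. -/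
theorem exists_support_eq_Ici [CompactSpace Y] [OrderClosedTopology Y]
    (hΦ : IsFinCocontinuous T Φ) (hΦ' : ∀ f g, Φ (ten T m f g) = T.ten (Φ f) (Φ g))
    (hΦ1 : Φ (const Y 1) = 1) : ∃ y, support Φ = Ici y := by
  have hrep := eq_iSup_support hΦ fun f g => (hΦ' f g).le
  suffices h : ∃ y ∈ support Φ, ∀ z ∈ support Φ, y ≤ z by
    obtain ⟨y, hy, hy'⟩ := h
    exact ⟨y, Subset.antisymm hy' fun z hz => isUpperSet_support Φ hz hy⟩
  by_contra! h
  obtain ⟨r, hr0, hr1⟩ := exists_between (zero_lt_one : (0 : I) < 1)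
  -- Without a least element, each `y` in the support has a `z` in the support with `¬ y ≤ z`. A
  -- function that is `1` at `z` and `0` at `y` has `Φ`-value `1` and is small near `y`; tensoring
  -- finitely many makes it small on the whole support. The empty support is excluded too, through
  -- `hΦ1`.
  obtain ⟨χ, hχ, hχ'⟩ : ∃ χ : AntiMap Y,
      (∀ y ∈ support Φ, χ y ≤ r) ∧ Φ χ = 1 := by
    refine (isClosed_support Φ).isCompact.induction_on
      (p := fun S => ∃ χ : AntiMap Y, (∀ y ∈ S, χ y ≤ r) ∧ Φ χ = 1)
      ⟨const Y 1, by simp, hΦ1⟩ ?_ ?_ ?_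
    · rintro S S' hS ⟨χ, h₁, h₂⟩
      exact ⟨χ, fun y hy => h₁ y (hS hy), h₂⟩
    · rintro S S' ⟨χ, h₁, h₂⟩ ⟨χ', h₁', h₂'⟩
      refine ⟨ten T m χ χ', ?_, by rw [hΦ', h₂, h₂', T.ten_one]⟩
      rintro y (hy | hy)
      · exact (T.ten_le_left _ _).trans (h₁ y hy)
      · exact (T.ten_le_right _ _).trans (h₁' y hy)
    · intro y hy
      obtain ⟨z, hz, hyz⟩ := h y hy
      obtain ⟨f, hf, hf', h₁, h₂⟩ := exists_antitone_continuous (isClosed_Iic (a := z))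
        (isLowerSet_Iic z) (isClosed_Ici (a := y)) (isUpperSet_Ici y)
        (Set.disjoint_left.2 fun w hw hw' => hyz (le_trans hw' hw))
      refine ⟨_, mem_nhdsWithin_of_mem_nhds
        ((isOpen_Iio.preimage hf).mem_nhds (x := y) (s := f ⁻¹' Iio r) ?_),
        ⟨f, hf, hf'⟩, fun w hw => le_of_lt hw, ?_⟩
      · rw [mem_preimage, h₂ y le_rfl]
        exact hr0
      · refine le_antisymm (Φ _).2.2 (le_trans ?_ (hz _))
        exact (h₁ z le_rfl).ge
  rw [hrep] at hχ'
  have : (1 : I) ≤ r := hχ' ▸ iSup_le fun y => hχ y y.2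
  exact this.not_gt hr1

end Representation

/-! ### Morphisms between objects of antitone continuous functions -/

section Morphisms

variable {X : Type u} {Y : Type v} [TopologicalSpace X] [PartialOrder X]
  [TopologicalSpace Y] [PartialOrder Y] [CompactSpace Y] [OrderClosedTopology Y]

theorem exists_of_not_le {y z : Y} (h : ¬ y ≤ z) : ∃ f : AntiMap Y, f z = 1 ∧ f y = 0 := by
  obtain ⟨f, hf, hf', h₁, h₂⟩ := exists_antitone_continuous (isClosed_Iic (a := z))
    (isLowerSet_Iic z) (isClosed_Ici (a := y)) (isUpperSet_Ici y)
    (Set.disjoint_left.2 fun w hw hw' => h (le_trans hw' hw))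
  exact ⟨⟨f, hf, hf'⟩, h₁ z le_rfl, h₂ y le_rfl⟩

theorem le_iff_forall {y z : Y} : y ≤ z ↔ ∀ f : AntiMap Y, f z ≤ f y := by
  refine ⟨fun h f => f.antitone h, fun h => ?_⟩
  by_contra hyz
  obtain ⟨f, h₁, h₂⟩ := exists_of_not_le hyz
  exact (zero_lt_one : (0 : I) < 1).not_ge (h₁ ▸ h₂ ▸ h f)

/-- If `y` is outside the closed upper set `φ x`, then `Iic y` is disjoint from it, and the ordered
Urysohn lemma separates the two. -/
theorem rel_iff_forall (φ : ContDist X Y) {x : X} {y : Y} :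
    φ.Rel x y ↔ ∀ f : AntiMap Y, f y ≤ pull φ f x := by
  refine ⟨fun h f => le_iSup (fun y : {y // φ.Rel x y} => f y) ⟨y, h⟩, fun h => ?_⟩
  by_contra hxy
  obtain ⟨f, hf, hf', h₁, h₂⟩ := exists_antitone_continuous (isClosed_Iic (a := y))
    (isLowerSet_Iic y) (φ x).isClosed (φ x).isUpper
    (Set.disjoint_left.2 fun w hw hw' => hxy ((φ x).isUpper hw hw'))
  have h0 : pull φ ⟨f, hf, hf'⟩ x ≤ 0 := iSup_le fun y => (h₂ y.1 y.2).le
  exact (zero_lt_one : (0 : I) < 1).not_ge ((h₁ y le_rfl).ge.trans ((h ⟨f, hf, hf'⟩).trans h0))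

theorem pull_injective : Function.Injective (pull : ContDist X Y → AntiMap Y → AntiMap X) :=
  fun φ ψ h => ContDist.ext_rel fun x y => by rw [rel_iff_forall, rel_iff_forall, h]

theorem comp_injective :
    Function.Injective fun (g : X →Co Y) (f : AntiMap Y) => comp f g := by
  intro g g' h
  have h' : ∀ (f : AntiMap Y) (x : X), f (g x) = f (g' x) := fun f x =>
    DFunLike.congr_fun (congrFun h f) x
  exact DFunLike.ext _ _ fun x => le_antisymm (le_iff_forall.2 fun f => (h' f x).ge)
    (le_iff_forall.2 fun f => (h' f x).le)

theorem isInducing_apply : IsInducing fun (y : Y) (f : AntiMap Y) => f y :=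
  ((continuous_pi fun f => f.continuous).isClosedEmbedding fun _ _ h =>
    le_antisymm (le_iff_forall.2 fun f => (congrFun h f).ge)
      (le_iff_forall.2 fun f => (congrFun h f).le)).isInducing

variable {T : UnitQuantale} {m : Prop} [hT : IsDualizing T m]

theorem exists_pull_eq {F : AntiMap Y → AntiMap X} (hF : IsLaxHom T m F) :
    ∃ φ : ContDist X Y, pull φ = F := by
  have hc : ∀ x, IsFinCocontinuous T fun f => F f x := fun x =>
    (isFinCocontinuous_eval hT x).comp hF.cocontinuous
  have hm : ∀ x f g, F (ten T m f g) x ≤ T.ten (F f x) (F g x) := fun x f g =>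
    natLE_iff.1 (hF.map_mul_le f g) x
  have hrep : ∀ x f, F f x = ⨆ y : support fun f => F f x, f y := fun x =>
    eq_iSup_support (hc x) (hm x)
  let φ : ContDist X Y :=
    { toFun := fun x => ⟨support fun f => F f x, isClosed_support _, isUpperSet_support _⟩
      monotone' := fun x x' h y hy f => (hy f).trans ((F f).antitone h)
      continuous_toFun := continuous_vietoris
        -- Take `f` equal to `1` at `y` and `0` off `U`: where `F f` is positive, the support must
        -- meet `U`.
        (fun U hU hU' => isOpen_iff_mem_nhds.2 fun x ⟨y, hy, hyU⟩ => by
          obtain ⟨f, hf, hf', h₁, h₂⟩ := exists_antitone_continuous (isClosed_Iic (a := y))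
            (isLowerSet_Iic y) hU.isClosed_compl hU'.compl
            (Set.disjoint_left.2 fun w hw hw' => hw' (hU' hw hyU))
          have hx : 0 < F ⟨f, hf, hf'⟩ x :=
            (zero_lt_one : (0 : I) < 1).trans_le ((h₁ y le_rfl).ge.trans (hy ⟨f, hf, hf'⟩))
          filter_upwards [(isOpen_Ioi.preimage (F ⟨f, hf, hf'⟩).continuous).mem_nhds hx]
            with x' hx'
          rw [mem_preimage, mem_Ioi, hrep, lt_iSup_iff] at hx'
          obtain ⟨z, hz⟩ := hx'
          refine ⟨z, z.2, ?_⟩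
          by_contra hzU
          exact hz.ne' (h₂ z hzU))
        -- Take `f` equal to `1` on `K` and `0` on the support at `x`: where `F f < 1`, the support
        -- cannot meet `K`.
        (fun K hK hK' => isOpen_iff_mem_nhds.2 fun x hx => by
          obtain ⟨f, hf, hf', h₁, h₂⟩ := exists_antitone_continuous hK hK'
            (isClosed_support fun f => F f x) (isUpperSet_support fun f => F f x)
            (Set.disjoint_iff_inter_eq_empty.2 ((inter_comm _ _).trans hx))
          have hx0 : F ⟨f, hf, hf'⟩ x < 1 := by
            rw [hrep]
            exact lt_of_le_of_lt (iSup_le fun y => (h₂ y.1 y.2).le) zero_lt_one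
          filter_upwards [(isOpen_Iio.preimage (F ⟨f, hf, hf'⟩).continuous).mem_nhds hx0]
            with x' hx'
          refine eq_empty_of_forall_notMem fun y hy => ?_
          exact (lt_of_le_of_lt (hy.1 ⟨f, hf, hf'⟩) hx').ne (h₁ y hy.2)) }
  exact ⟨φ, funext fun f => ext' fun x => (hrep x f).symm⟩

theorem exists_comp_eq {F : AntiMap Y → AntiMap X} (hF : IsPowHom T m F) :
    ∃ g : X →Co Y, (fun f => comp f g) = F := by
  have hc : ∀ x, IsPowHom T m fun f => F f x := fun x => (isPowHom_eval x).comp hF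
  have hex : ∀ x, ∃ y, support (fun f => F f x) = Ici y := fun x =>
    exists_support_eq_Ici (m := m) (hc x).cocontinuous (hc x).map_mul (hc x).map_one
  choose g hg using hex
  have hrep : ∀ x f, F f x = f (g x) := fun x f => by
    rw [eq_iSup_support (Φ := fun f => F f x) (m := m) (hc x).cocontinuous
      fun f f' => ((hc x).map_mul f f').le]
    have hmem : ∀ y, y ∈ support (fun f => F f x) ↔ g x ≤ y := fun y => by rw [hg]; rfl
    exact le_antisymm (iSup_le fun y => f.antitone ((hmem _).1 y.2))
      (le_iSup (fun y : support fun f => F f x => f y) ⟨g x, (hmem _).2 le_rfl⟩)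
  refine ⟨⟨⟨g, fun x x' h => le_iff_forall.2 fun f => ?_⟩, ?_⟩,
    funext fun f => ext' fun x => (hrep x f).symm⟩
  · rw [← hrep, ← hrep]
    exact (F f).antitone h
  · refine isInducing_apply.continuous_iff.2 (continuous_pi fun f => ?_)
    change Continuous fun x => f (g x)
    simp only [← hrep]
    exact (F f).continuous

end Morphisms

/-! ### A Stone–Weierstrass theorem -/

section StoneWeierstrass

variable {T : UnitQuantale} {m : Prop} [hT : IsDualizing T m] {Y : Type u}
  [TopologicalSpace Y] [PartialOrder Y]

variable (T m) in
/-- Sets of functions that are closed under the operations and determine the order. -/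
structure IsSeparating (R : Set (AntiMap Y)) : Prop where
  one_mem : const Y 1 ∈ R
  zero_mem : const Y 0 ∈ R
  tensor_mem : ∀ a, ∀ f ∈ R, ten T m (const Y a) f ∈ R
  sup_mem : ∀ f ∈ R, ∀ g ∈ R, sup f g ∈ R
  ten_mem : ∀ f ∈ R, ∀ g ∈ R, ten T m f g ∈ R
  pow_mem : ∀ a, ∀ f ∈ R, pow T m f a ∈ R
  exists_lt : ∀ y z, ¬ y ≤ z → ∃ f ∈ R, f y < f z

namespace IsSeparating

variable {R : Set (AntiMap Y)}

theorem const_mem (hR : IsSeparating T m R) (a : I) : const Y a ∈ R := by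
  have h := hR.tensor_mem a _ hR.one_mem
  rwa [show ten T m (const Y a) (const Y 1) = const Y a from ext' fun _ => T.ten_one a] at h

theorem iterate_mem (hR : IsSeparating T m R) {f : AntiMap Y} (hf : f ∈ R) (n : ℕ) :
    (ten T m f)^[n] (const Y 1) ∈ R := by
  induction n with
  | zero => exact hR.one_mem
  | succ n ih =>
    rw [Function.iterate_succ_apply']
    exact hR.ten_mem _ hf _ ih

/-- With `f l < t < s < f k`, the `s`-power of `f` is `1` near `k` and at most `hom s t < 1` near
`l`; high tensor powers sharpen this. -/
theorem exists_local (hR : IsSeparating T m R) {k l : Y} (h : ¬ l ≤ k) {ε : I} (hε : 0 < ε) :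
    ∃ χ ∈ R, (∀ᶠ y in 𝓝 k, χ y = 1) ∧ ∀ᶠ y in 𝓝 l, χ y ≤ ε := by
  obtain ⟨f, hf, hlk⟩ := hR.exists_lt l k h
  obtain ⟨s, hs, hs'⟩ := exists_between hlk
  obtain ⟨t, ht, ht'⟩ := exists_between hs
  obtain ⟨n, hn⟩ := hT.exists_iterate_lt (T.hom s t) (T.hom_lt_one ht') ε hε
  refine ⟨_, hR.iterate_mem (hR.pow_mem s f hf) n, ?_, ?_⟩
  · filter_upwards [(isOpen_Ioi.preimage f.continuous).mem_nhds hs'] with y hy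
    have : T.hom s (f y) = 1 :=
      le_antisymm (T.hom s (f y)).2.2 (T.one_le_hom_iff.2 (le_of_lt hy))
    rw [iterate_ten_apply, pow_apply, this, T.iterate_ten_one]
  · filter_upwards [(isOpen_Iio.preimage f.continuous).mem_nhds ht] with y hy
    rw [iterate_ten_apply, pow_apply]
    exact (T.iterate_ten_mono (T.hom_mono_right s (le_of_lt hy)) n).trans hn.le

/-- Two compactness arguments: for fixed `k`, a finite tensor product makes the function small on
all of `L`; then a finite join makes it `1` on all of `K`. -/
theorem exists_eq_one_le (hR : IsSeparating T m R) {K L : Set Y} (hK : IsCompact K)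
    (hL : IsCompact L) (h : ∀ k ∈ K, ∀ l ∈ L, ¬ l ≤ k) {ε : I} (hε : 0 < ε) :
    ∃ χ ∈ R, (∀ y ∈ K, χ y = 1) ∧ ∀ y ∈ L, χ y ≤ ε := by
  have step : ∀ k ∈ K, ∃ χ ∈ R, (∀ᶠ y in 𝓝 k, χ y = 1) ∧ ∀ y ∈ L, χ y ≤ ε := by
    intro k hk
    refine hL.induction_on
      (p := fun S => ∃ χ ∈ R, (∀ᶠ y in 𝓝 k, χ y = 1) ∧ ∀ y ∈ S, χ y ≤ ε)
      ⟨const Y 1, hR.one_mem, by simp, by simp⟩ ?_ ?_ ?_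
    · rintro S S' hS ⟨χ, hχ, h₁, h₂⟩
      exact ⟨χ, hχ, h₁, fun y hy => h₂ y (hS hy)⟩
    · rintro S S' ⟨χ, hχ, h₁, h₂⟩ ⟨χ', hχ', h₁', h₂'⟩
      refine ⟨ten T m χ χ', hR.ten_mem _ hχ _ hχ', ?_, ?_⟩
      · filter_upwards [h₁, h₁'] with y hy hy'
        rw [ten_apply, hy, hy', T.ten_one]
      · rintro y (hy | hy)
        · exact (T.ten_le_left _ _).trans (h₂ y hy)
        · exact (T.ten_le_right _ _).trans (h₂' y hy)
    · intro l hl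
      obtain ⟨χ, hχ, h₁, h₂⟩ := hR.exists_local (h k hk l hl) hε
      exact ⟨_, mem_nhdsWithin_of_mem_nhds h₂, χ, hχ, h₁, fun _ hy => hy⟩
  refine hK.induction_on (p := fun S => ∃ χ ∈ R, (∀ y ∈ S, χ y = 1) ∧ ∀ y ∈ L, χ y ≤ ε)
    ⟨const Y 0, hR.zero_mem, by simp, fun _ _ => hε.le⟩ ?_ ?_ ?_
  · rintro S S' hS ⟨χ, hχ, h₁, h₂⟩
    exact ⟨χ, hχ, fun y hy => h₁ y (hS hy), h₂⟩
  · rintro S S' ⟨χ, hχ, h₁, h₂⟩ ⟨χ', hχ', h₁', h₂'⟩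
    refine ⟨sup χ χ', hR.sup_mem _ hχ _ hχ', ?_, fun y hy => sup_le (h₂ y hy) (h₂' y hy)⟩
    rintro y (hy | hy)
    · exact le_antisymm (sup χ χ' y).2.2 (le_sup_of_le_left (h₁ y hy).ge)
    · exact le_antisymm (sup χ χ' y).2.2 (le_sup_of_le_right (h₁' y hy).ge)
  · intro k hk
    obtain ⟨χ, hχ, h₁, h₂⟩ := step k hk
    exact ⟨_, mem_nhdsWithin_of_mem_nhds h₁, χ, hχ, fun _ hy => hy, h₂⟩

/-- A staircase of step `ε`: stage `n` approximates `g` from below up to height `n * ε`. The next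
stage joins a step of height `a` whose cutoff `χ` is `1` on `{g ≥ a}` and at most `ε` on `{g ≤ a -
ε}`. Such cutoffs exist because `g` is antitone. -/
theorem exists_approx_min [CompactSpace Y] (hR : IsSeparating T m R) (g : AntiMap Y) {ε : I}
    (hε : 0 < ε) (n : ℕ) : ∃ f ∈ R, ∀ y, (f y : ℝ) ≤ g y + ε ∧
      min (g y : ℝ) ((n : ℝ) * ε) - ε ≤ f y := by
  have hε0 : (0 : ℝ) < ε := hε
  induction n with
  | zero =>
    refine ⟨const Y 0, hR.zero_mem, fun y => ?_⟩
    have hg : (0 : ℝ) ≤ g y := (g y).2.1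
    simp only [const_apply, Set.Icc.coe_zero, Nat.cast_zero, zero_mul]
    exact ⟨by linarith, by linarith [min_le_right (g y : ℝ) 0]⟩
  | succ n ih =>
    obtain ⟨f, hf, hfg⟩ := ih
    let a : I := ⟨min 1 ((n : ℝ) * ε), le_min zero_le_one (by positivity), min_le_left _ _⟩
    have ha : (a : ℝ) = min 1 ((n : ℝ) * ε) := rfl
    obtain ⟨χ, hχ, h₁, h₂⟩ := hR.exists_eq_one_le (K := {y | a ≤ g y})
      (L := {y | (g y : ℝ) ≤ a - ε})
      (isClosed_le continuous_const g.continuous).isCompact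
      (isClosed_le (continuous_subtype_val.comp g.continuous) continuous_const).isCompact
      (fun k hk l hl hlk => by
        have hk' : (a : ℝ) ≤ g k := hk
        have hl' : (g l : ℝ) ≤ a - ε := hl
        have hlk' : (g k : ℝ) ≤ g l := g.antitone hlk
        linarith) hε
    refine ⟨sup f (ten T m (const Y a) χ), hR.sup_mem _ hf _ (hR.tensor_mem a _ hχ),
      fun y => ⟨?_, ?_⟩⟩
    · have hg : (0 : ℝ) ≤ g y := (g y).2.1
      have hsup : ((sup f (ten T m (const Y a) χ) y : I) : ℝ) =
        max (f y : ℝ) (T.ten a (χ y) : I) := Subtype.mono_coe _ |>.map_sup _ _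
      rw [hsup, max_le_iff]
      refine ⟨(hfg y).1, ?_⟩
      rcases le_or_gt (g y : ℝ) (a - ε) with hy | hy
      · have h3 : ((T.ten a (χ y) : I) : ℝ) ≤ ε := (T.ten_le_right _ _).trans (h₂ y hy)
        linarith
      · have h3 : ((T.ten a (χ y) : I) : ℝ) ≤ a := T.ten_le_left _ _
        linarith
    · rcases le_or_gt a (g y) with hy | hy
      · have h3 : a ≤ sup f (ten T m (const Y a) χ) y := by
          refine le_sup_of_le_right ?_
          rw [ten_apply, h₁ y hy, T.ten_one, const_apply]
        have h3' : (a : ℝ) ≤ (sup f (ten T m (const Y a) χ) y : I) := h3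
        refine le_trans ?_ h3'
        have hg : (g y : ℝ) ≤ 1 := (g y).2.2
        rw [ha]
        push_cast
        refine le_min ?_ ?_
        · linarith [min_le_left (g y : ℝ) (((n : ℝ) + 1) * ε)]
        · linarith [min_le_right (g y : ℝ) (((n : ℝ) + 1) * ε)]
      · have h3 : (f y : ℝ) ≤ (sup f (ten T m (const Y a) χ) y : I) :=
          (le_sup_left : f y ≤ sup f (ten T m (const Y a) χ) y)
        have hy' : (g y : ℝ) ≤ (n : ℝ) * ε :=
          le_trans (le_of_lt hy) (min_le_right 1 ((n : ℝ) * (ε : ℝ)))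
        have h4 := (hfg y).2
        rw [min_eq_left hy'] at h4
        linarith [min_le_left (g y : ℝ) (((n + 1 : ℕ) : ℝ) * ε)]

theorem exists_approx [CompactSpace Y] (hR : IsSeparating T m R) (g : AntiMap Y) {ε : ℝ}
    (hε : 0 < ε) : ∃ f ∈ R, ∀ y, (f y : ℝ) ≤ g y + ε ∧ (g y : ℝ) ≤ f y + ε := by
  let ε' : I := ⟨min 1 ε, le_min zero_le_one hε.le, min_le_left _ _⟩
  have hε' : (0 : ℝ) < ε' := lt_min zero_lt_one hε
  have hεε' : (ε' : ℝ) ≤ ε := min_le_right _ _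
  obtain ⟨n, hn⟩ := exists_nat_gt (1 / (ε' : ℝ))
  rw [div_lt_iff₀ hε'] at hn
  obtain ⟨f, hf, hfg⟩ := hR.exists_approx_min g (ε := ε') hε' n
  refine ⟨f, hf, fun y => ⟨by linarith [(hfg y).1], ?_⟩⟩
  have h := (hfg y).2
  have hg : (g y : ℝ) ≤ 1 := (g y).2.2
  rw [min_eq_left (by linarith)] at h
  linarith

/-- Approximation with respect to the enriched structure, for functions with values in the range
where it is implied by uniform approximation. -/
theorem exists_le_dist [CompactSpace Y] (hR : IsSeparating T m R) {r : I}
    (hr : ∀ δ < 1, ∃ ε : ℝ, 0 < ε ∧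
      ∀ a b : I, r ≤ a → r ≤ b → (a : ℝ) ≤ b + ε → T.ten a δ ≤ b)
    (g : AntiMap Y) (hg : ∀ y, r ≤ g y) {δ : I} (hδ : δ < 1) :
    ∃ f ∈ R, δ ≤ dist T g f ∧ δ ≤ dist T f g := by
  obtain ⟨ε, hε, h⟩ := hr δ hδ
  obtain ⟨f, hf, hfg⟩ := hR.exists_approx g hε
  -- Joining with `r` moves the approximant into `[r, 1]` and costs nothing, as `g ≥ r`.
  refine ⟨sup f (const Y r), hR.sup_mem _ hf _ (hR.const_mem r),
    le_dist_iff.2 fun y => h _ _ (hg y) le_sup_right ?_,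
    le_dist_iff.2 fun y => h _ _ le_sup_right (hg y) ?_⟩
  · have h3 : (f y : ℝ) ≤ (sup f (const Y r) y : I) := (le_sup_left : f y ≤ f y ⊔ r)
    linarith [(hfg y).2]
  · have hgr : (r : ℝ) ≤ g y := hg y
    have hsup : ((sup f (const Y r) y : I) : ℝ) = max (f y : ℝ) r :=
      Subtype.mono_coe _ |>.map_sup _ _
    rw [hsup, max_le_iff]
    exact ⟨(hfg y).1, by linarith⟩

end IsSeparating

end StoneWeierstrass

end AntiMap

/-! ### The space of characters -/

section Spectrum

/-- The characters of an object. -/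
@[ext]
structure Spectrum (T : UnitQuantale) (m : Prop) (X : Type u) [CoctsMonoid T m X] where
  toFun : X → I
  isPowHom : IsPowHom T m toFun

variable {T : UnitQuantale} {m : Prop} {X : Type u} [CoctsMonoid T m X]

namespace Spectrum

instance : TopologicalSpace (Spectrum T m X) := TopologicalSpace.induced toFun inferInstance

/-- The pointwise order is reversed so that evaluations become antitone. -/
instance : PartialOrder (Spectrum T m X) where
  le φ ψ := ∀ x, ψ.toFun x ≤ φ.toFun x
  le_refl _ _ := le_rfl
  le_trans _ _ _ h h' x := (h' x).trans (h x)
  le_antisymm _ _ h h' := Spectrum.ext (funext fun x => le_antisymm (h' x) (h x))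

theorem le_iff {φ ψ : Spectrum T m X} : φ ≤ ψ ↔ ∀ x, ψ.toFun x ≤ φ.toFun x := Iff.rfl

theorem continuous_apply (x : X) : Continuous fun φ : Spectrum T m X => φ.toFun x :=
  (_root_.continuous_apply x).comp continuous_induced_dom

instance : OrderClosedTopology (Spectrum T m X) where
  isClosed_le' := by
    simp only [le_iff, ofPred_forall]
    exact isClosed_iInter fun x => isClosed_le ((continuous_apply x).comp continuous_snd)
      ((continuous_apply x).comp continuous_fst)

/-- In this form every clause compares continuous functions of finitely many coordinates of `φ`, so
characters form a closed subset of the cube. -/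
theorem _root_.UnitDuality.isPowHom_unit_iff {φ : X → I} : IsPowHom T m φ ↔
    (∀ x y, T.ten (φ x) (dist T x y) ≤ φ y) ∧
    (∀ (A : Type) (_ : Finite A) (_ : VCat T A) (h : A → X) (ψ : A → I) (_ : IsVFunctor T h)
      (_ : IsWeight T ψ) (x₀ : X) (_ : IsColimit T h ψ x₀),
      φ x₀ = ⨆ z, T.ten (φ (h z)) (ψ z)) ∧
    (∀ x y, φ (cmul T m x y) = T.ten (φ x) (φ y)) ∧ φ (cunit T m X) = 1 ∧
    (∀ (x : X) (a : I) (p : X) (_ : IsPower T x a p), φ p = T.hom a (φ x)) ∧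
    ∀ (hm : m) (x : X) (a : I), φ (cminus T m hm x a) = truncSub (φ x) a := by
  constructor
  · exact fun h => ⟨fun x y => T.le_hom_iff.1 (h.cocontinuous.isVFunctor x y),
      fun A _ _ k ψ hk hψ x₀ hx =>
        unit_isColimit_unique T (h.cocontinuous.preserves A k ψ hk hψ x₀ hx),
      h.map_mul, h.map_one, fun x a p hp => unit_isPower_iff.1 (h.map_power x a p hp),
      h.map_minus⟩
  · rintro ⟨h₁, h₂, h₃, h₄, h₅, h₆⟩
    refine ⟨⟨fun x y => T.le_hom_iff.2 (h₁ x y), fun A hA hA' k ψ hk hψ x₀ hx => ?_⟩, h₃, h₄,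
      fun x a p hp => unit_isPower_iff.2 (h₅ x a p hp), h₆⟩
    rw [h₂ A hA hA' k ψ hk hψ x₀ hx]
    exact unit_isColimit T (φ ∘ k) ψ

theorem _root_.UnitDuality.isClosed_isPowHom [hT : IsDualizing T m] :
    IsClosed {φ : X → I | IsPowHom T m φ} := by
  simp only [isPowHom_unit_iff, ofPred_and, ofPred_forall]
  have hc := fun x : X => _root_.continuous_apply (A := fun _ : X => I) x
  refine ((isClosed_iInter fun x => isClosed_iInter fun y => ?_).inter
    ((isClosed_iInter fun A => isClosed_iInter fun hA => isClosed_iInter fun _ =>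
      isClosed_iInter fun h => isClosed_iInter fun ψ => isClosed_iInter fun _ =>
      isClosed_iInter fun _ => isClosed_iInter fun x₀ => isClosed_iInter fun _ => ?_).inter
    ((isClosed_iInter fun x => isClosed_iInter fun y => ?_).inter (IsClosed.inter ?_
    ((isClosed_iInter fun x => isClosed_iInter fun a => isClosed_iInter fun p =>
      isClosed_iInter fun _ => ?_).inter
    (isClosed_iInter fun hm => isClosed_iInter fun x => isClosed_iInter fun a => ?_))))))
  · exact isClosed_le (hT.continuous_ten.comp ((hc x).prodMk continuous_const)) (hc y)
  · have := hA
    have := Fintype.ofFinite A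
    simp only [← Finset.sup_univ_eq_iSup]
    exact isClosed_eq (hc x₀) (Continuous.finset_sup_apply fun z _ =>
      hT.continuous_ten.comp ((hc (h z)).prodMk continuous_const))
  · exact isClosed_eq (hc _) (hT.continuous_ten.comp ((hc x).prodMk (hc y)))
  · exact isClosed_eq (hc _) continuous_const
  · exact isClosed_eq (hc _) ((hT.continuous_hom a).comp (hc x))
  · exact isClosed_eq (hc _) ((continuous_truncSub a).comp (hc x))

instance [IsDualizing T m] : CompactSpace (Spectrum T m X) := by
  rw [← isCompact_univ_iff, (IsInducing.induced toFun).isCompact_iff, image_univ]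
  have : range (toFun : Spectrum T m X → X → I) = {φ | IsPowHom T m φ} :=
    Set.ext fun φ => ⟨fun ⟨ψ, hψ⟩ => hψ ▸ ψ.isPowHom, fun h => ⟨⟨φ, h⟩, rfl⟩⟩
  rw [this]
  exact isClosed_isPowHom.isCompact

/-- Evaluation of characters. -/
def ev (x : X) : AntiMap (Spectrum T m X) :=
  ⟨fun φ => φ.toFun x, continuous_apply x, fun _ _ h => h x⟩

theorem ev_apply (x : X) (φ : Spectrum T m X) : ev x φ = φ.toFun x := rfl

theorem ev_injective
    (hE : ∀ x y : X, (∀ φ : X → I, IsPowHom T m φ → φ x = φ y) → x = y) :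
    Function.Injective (ev : X → AntiMap (Spectrum T m X)) := fun x y h =>
  hE x y fun φ hφ => DFunLike.congr_fun h (⟨φ, hφ⟩ : Spectrum T m X)

/-- Characters preserve joins, so they cannot distinguish the join of `x` and `y` from `y`. -/
theorem natLE_of_forall
    (hE : ∀ x y : X, (∀ φ : X → I, IsPowHom T m φ → φ x = φ y) → x = y) {x y : X}
    (h : ∀ φ : Spectrum T m X, φ.toFun x ≤ φ.toFun y) :
    NatLE T x y := by
  obtain ⟨p, hp⟩ := (CoctsMonoid.finitelyCocomplete (m := m) : FinitelyCocomplete T X).exists_isJoin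
    x y
  have hpy : p = y := ev_injective hE (AntiMap.ext' fun φ => by
    rw [ev_apply, ev_apply, φ.isPowHom.cocontinuous.map_join hp, sup_eq_right.2 (h φ)])
  have h1 := hp p
  rw [dist_self] at h1
  have h2 : (1 : I) ≤ dist T x p := h1.le.trans inf_le_left
  rwa [hpy] at h2

section Reflexive

variable [hT : IsDualizing T m]

theorem isPowHom_ev : IsPowHom T m (ev : X → AntiMap (Spectrum T m X)) :=
  AntiMap.isPowHom_of_apply fun φ => φ.isPowHom

/-- Let `d` be the distance of the evaluations. On every character `x` lies below the `d`-power of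
`y`, hence it does so in `X`, which says `d ≤ dist T x y`. -/
theorem dist_ev
    (hE : ∀ x y : X, (∀ φ : X → I, IsPowHom T m φ → φ x = φ y) → x = y)
    (hP : Powered T X) (x y : X) :
    dist T (ev (T := T) (m := m) x) (ev y) = dist T x y := by
  refine le_antisymm ?_ (isPowHom_ev.cocontinuous.isVFunctor x y)
  obtain ⟨p, hp⟩ := hP y (dist T (ev (T := T) (m := m) x) (ev y))
  have h : NatLE T x p := natLE_of_forall hE fun φ => by
    rw [unit_isPower_iff.1 (φ.isPowHom.map_power _ _ _ hp), T.le_hom_iff, T.ten_comm]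
    exact AntiMap.le_dist_iff.1 (le_refl (dist T (ev (T := T) (m := m) x) (ev y))) φ
  rw [NatLE, hp] at h
  exact T.one_le_hom_iff.1 h

theorem isSeparating_range_ev (hP : Powered T X) :
    AntiMap.IsSeparating T m (range (ev : X → AntiMap (Spectrum T m X))) where
  one_mem := ⟨_, isPowHom_ev.map_one⟩
  zero_mem := by
    obtain ⟨p, hp⟩ := (CoctsMonoid.finitelyCocomplete (m := m) :
      FinitelyCocomplete T X).exists_isBottom
    exact ⟨p, AntiMap.ext' fun φ => φ.isPowHom.cocontinuous.map_bottom hp⟩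
  tensor_mem := by
    rintro a _ ⟨x, rfl⟩
    obtain ⟨p, hp⟩ := (CoctsMonoid.finitelyCocomplete (m := m) :
      FinitelyCocomplete T X).exists_isTensor x a
    exact ⟨p, AntiMap.ext' fun φ => φ.isPowHom.cocontinuous.map_tensor hp⟩
  sup_mem := by
    rintro _ ⟨x, rfl⟩ _ ⟨y, rfl⟩
    obtain ⟨p, hp⟩ := (CoctsMonoid.finitelyCocomplete (m := m) :
      FinitelyCocomplete T X).exists_isJoin x y
    exact ⟨p, AntiMap.ext' fun φ => φ.isPowHom.cocontinuous.map_join hp⟩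
  ten_mem := by
    rintro _ ⟨x, rfl⟩ _ ⟨y, rfl⟩
    exact ⟨_, isPowHom_ev.map_mul x y⟩
  pow_mem := by
    rintro a _ ⟨x, rfl⟩
    obtain ⟨p, hp⟩ := hP x a
    exact ⟨p, AntiMap.ext' fun φ => unit_isPower_iff.1 (φ.isPowHom.map_power _ _ _ hp)⟩
  exists_lt φ ψ h := by
    simp only [le_iff, not_forall, not_le] at h
    obtain ⟨x, hx⟩ := h
    exact ⟨ev x, ⟨x, rfl⟩, hx⟩

/-- The distances to and from `g` form an adjoint pair of distributors on `X`; the approximations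
supply the unit condition `hsup`. The colimit `x₀` of the identity with this weight has the same
distances to all `ev x` as `g`, so `ev x₀ = g`. -/
theorem mem_range_ev_of_approx
    (hE : ∀ x y : X, (∀ φ : X → I, IsPowHom T m φ → φ x = φ y) → x = y)
    (hP : Powered T X) (hC : CauchyComplete T X)
    {g : AntiMap (Spectrum T m X)}
    (hg : ∀ δ < 1, ∃ x : X, δ ≤ dist T g (ev x) ∧ δ ≤ dist T (ev x) g) : g ∈ range ev := by
  have hd := dist_ev hE hP
  have hsup : 1 ≤ ⨆ x : X, T.ten (dist T g (ev x)) (dist T (ev x) g) := by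
    -- By continuity of `d ↦ d ⊗ d` at `1`, some `δ < 1` still satisfies `c < δ ⊗ δ`.
    refine le_of_forall_lt fun c hc => ?_
    have hcont : Continuous fun d : I => T.ten d d :=
      hT.continuous_ten.comp (continuous_id.prodMk continuous_id)
    have h1 : ∀ᶠ d in 𝓝 (1 : I), c < T.ten d d :=
      (isOpen_Ioi.preimage hcont).mem_nhds (by rwa [mem_preimage, T.ten_one])
    have := nhdsLT_neBot_of_exists_lt ⟨(0 : I), zero_lt_one⟩
    obtain ⟨δ, hδ, hδ1⟩ := ((h1.filter_mono nhdsWithin_le_nhds).and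
      (self_mem_nhdsWithin : Iio (1 : I) ∈ 𝓝[<] 1)).exists
    obtain ⟨x, hx, hx'⟩ := hg δ hδ1
    exact lt_of_lt_of_le (hδ.trans_le (T.ten_mono hx hx')) (le_iSup
      (fun x : X => T.ten (dist T g (ev x)) (dist T (ev x) g)) x)
  obtain ⟨x₀, hx₀⟩ := hC X id (fun x => dist T (ev x) g) (fun _ _ => le_rfl)
    (fun x y => by rw [← hd]; exact dist_trans _ _ _)
    ⟨fun x => dist T g (ev x), fun x y => by rw [← hd]; exact dist_trans _ _ _, hsup,
      fun x y => by rw [← hd]; exact dist_trans _ _ _⟩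
  have key : ∀ x, dist T (ev (T := T) (m := m) x₀) (ev x) = dist T g (ev x) := fun x => by
    rw [hd, hx₀]
    refine le_antisymm ?_ (le_iInf fun z => T.le_hom_iff.2 ?_)
    · refine (T.one_ten _).symm.le.trans ((T.ten_mono hsup le_rfl).trans ?_)
      rw [T.iSup_ten]
      refine iSup_le fun z => ?_
      rw [T.ten_assoc]
      refine (T.ten_mono_right _ ((T.ten_mono_right _ (iInf_le _ z)).trans
        (T.ten_hom_le _ _))).trans ?_
      rw [id_eq, ← hd]
      exact dist_trans _ _ _
    · rw [id_eq, ← hd]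
      exact dist_trans _ _ _
  refine ⟨x₀, AntiMap.separated (T := T) _ _ ?_ ?_⟩
  · refine hsup.trans (iSup_le fun x => ?_)
    rw [← key]
    exact dist_trans _ _ _
  · rw [NatLE, ← key, dist_self]

/-- Functions with values in `[r, 1]` are reached by approximation. If `r` is not `0`, a general `g`
is compressed by `F`, and its preimage is corrected by `⊖ r` and the `r`-power, both of which `ev`
preserves. -/
theorem ev_surjective
    (hE : ∀ x y : X, (∀ φ : X → I, IsPowHom T m φ → φ x = φ y) → x = y)
    (hP : Powered T X) (hC : CauchyComplete T X) :
    Function.Surjective (ev : X → AntiMap (Spectrum T m X)) := by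
  obtain ⟨r, hr, hr'⟩ := hT.exists_range
  have hS := isSeparating_range_ev (m := m) hP
  have main : ∀ g : AntiMap (Spectrum T m X), (∀ φ, r ≤ g φ) → g ∈ range ev := fun g hg =>
    mem_range_ev_of_approx hE hP hC fun δ hδ => by
      obtain ⟨_, ⟨x, rfl⟩, hx⟩ := hS.exists_le_dist hr g hg hδ
      exact ⟨x, hx⟩
  intro g
  rcases hr' with rfl | ⟨hm, F, hF, hF', hrF, h⟩
  · exact main g fun _ => zero_le
  · obtain ⟨x, hx⟩ := main (AntiMap.map F hF hF' g) fun φ => hrF _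
    have h2 : AntiMap.pow T m (cminus T m hm (ev x) r) r ∈
        range (ev : X → AntiMap (Spectrum T m X)) :=
      hS.pow_mem r _ ⟨_, isPowHom_ev.map_minus hm x r⟩
    have h3 : AntiMap.pow T m (cminus T m hm (ev x) r) r = g := AntiMap.ext' fun φ => by
      rw [AntiMap.pow_apply, AntiMap.cminus_apply, hx]
      exact h (g φ)
    rwa [h3] at h2

end Reflexive

end Spectrum

end Spectrum

/-! ### The equivalences -/

section Equivalences

variable (T : UnitQuantale) (m : Prop) [hT : IsDualizing T m]

/-- The object of antitone continuous functions on a partially ordered compact space. -/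
noncomputable def antiObj (X : PosComp.{u}) : ACat.{u} T m :=
  ⟨AntiMap X.carrier, AntiMap.powered hT⟩

theorem isCC_antiObj (X : PosComp.{u}) : ACat.IsCC (antiObj T m X) :=
  ⟨AntiMap.cauchyComplete hT, AntiMap.hasEnoughCharacters⟩

variable {T m} in
/-- The character space as a partially ordered compact space. -/
def spectrumObj (X : ACat.{u} T m) : PosComp.{u} := ⟨Spectrum T m X.carrier⟩

/-- Serves both equivalences, since strict morphisms are in particular lax ones. -/
theorem exists_inverse_ev {X : ACat.{u} T m} (hX : ACat.IsCC X) :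
    ∃ g : AntiMap (Spectrum T m X.carrier) → X.carrier, IsPowHom T m g ∧
      (∀ f, Spectrum.ev (g f) = f) ∧ ∀ x, g (Spectrum.ev x) = x := by
  have hb : Function.Bijective (Spectrum.ev : X.carrier → AntiMap (Spectrum T m X.carrier)) :=
    ⟨Spectrum.ev_injective hX.2, Spectrum.ev_surjective hX.2 X.powered hX.1⟩
  obtain ⟨g, hg, hg'⟩ := Function.bijective_iff_has_inverse.1 hb
  exact ⟨g, Spectrum.isPowHom_ev.inverse (Spectrum.dist_ev hX.2 X.powered) hg' hg, hg', hg⟩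

/-- The functor of antitone continuous functions on partially ordered compact spaces. -/
noncomputable def antiFunctor : PosComp.{u} ⥤ (ACC.{u} T m)ᵒᵖ where
  obj X := Opposite.op ⟨antiObj T m X, isCC_antiObj T m X⟩
  map {X Y} g := Quiver.Hom.op (ObjectProperty.homMk
    (X := ⟨antiObj T m Y, isCC_antiObj T m Y⟩) (Y := ⟨antiObj T m X, isCC_antiObj T m X⟩)
    (⟨fun f => AntiMap.comp f g, AntiMap.isPowHom_comp g⟩ :
      ACat.Hom (antiObj T m Y) (antiObj T m X)))
  map_id _ := rfl
  map_comp _ _ := rfl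

theorem antiFunctor_map_toFun {X Y : PosComp.{u}} (g : X ⟶ Y) :
    ((antiFunctor T m).map g).unop.hom.toFun = fun f => AntiMap.comp f g := rfl

instance : (antiFunctor.{u} T m).Faithful where
  map_injective {X Y g g'} h := AntiMap.comp_injective (by
    change (fun f => AntiMap.comp f g) = fun f => AntiMap.comp f g'
    rw [← antiFunctor_map_toFun T m g, ← antiFunctor_map_toFun T m g', h])

instance : (antiFunctor.{u} T m).Full where
  map_surjective {X Y} F := by
    obtain ⟨g, hg⟩ := AntiMap.exists_comp_eq (X := X.carrier) (Y := Y.carrier)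
      F.unop.hom.isPowHom
    exact ⟨g, Quiver.Hom.unop_inj (InducedCategory.hom_ext (ACat.Hom.ext hg))⟩

instance : (antiFunctor.{u} T m).EssSurj where
  mem_essImage Z := by
    obtain ⟨g, hg, hg', hg''⟩ := exists_inverse_ev T m Z.unop.property
    let e : antiObj T m (spectrumObj Z.unop.obj) ≅ Z.unop.obj :=
      { hom := ⟨g, hg⟩
        inv := ⟨Spectrum.ev, Spectrum.isPowHom_ev⟩
        hom_inv_id := ACat.Hom.ext (funext hg')
        inv_hom_id := ACat.Hom.ext (funext hg'') }
    exact ⟨spectrumObj Z.unop.obj, ⟨(ObjectProperty.isoMk _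
      (X := Z.unop) (Y := ⟨antiObj T m (spectrumObj Z.unop.obj), isCC_antiObj T m _⟩)
      e.symm).op⟩⟩

instance : (antiFunctor.{u} T m).IsEquivalence where

/-- The object of antitone continuous functions, as an object of `BCC`. -/
noncomputable def antiDistObj (X : PosCompDist.{u}) : BCC.{u} T m :=
  ⟨antiObj T m X.space, isCC_antiObj T m X.space⟩

/-- Inverse image along a continuous distributor, as a morphism of `BCC`. -/
noncomputable def pullHom {X Y : PosCompDist.{u}} (φ : X ⟶ Y) :
    antiDistObj T m Y ⟶ antiDistObj T m X :=
  (⟨AntiMap.pull (X := X.space.carrier) (Y := Y.space.carrier) φ, AntiMap.isLaxHom_pull _⟩ :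
    BCC.Hom (antiDistObj T m Y) (antiDistObj T m X))

/-- The functor of antitone continuous functions on continuous distributors. -/
noncomputable def antiDistFunctor : PosCompDist.{u} ⥤ (BCC.{u} T m)ᵒᵖ where
  obj X := Opposite.op (antiDistObj T m X)
  map φ := (pullHom T m φ).op
  map_id X := Quiver.Hom.unop_inj (BCC.Hom.ext (funext
    (AntiMap.pull_id (X := X.space.carrier))))
  map_comp {X Y Z} φ ψ := Quiver.Hom.unop_inj (BCC.Hom.ext (funext
    (AntiMap.pull_comp (X := X.space.carrier) (Y := Y.space.carrier) (Z := Z.space.carrier) ψ φ)))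

theorem antiDistFunctor_map_toFun {X Y : PosCompDist.{u}} (φ : X ⟶ Y) :
    ((antiDistFunctor T m).map φ).unop.toFun = AntiMap.pull φ := rfl

instance : (antiDistFunctor.{u} T m).Faithful where
  map_injective {X Y φ ψ} h := AntiMap.pull_injective (by
    rw [← antiDistFunctor_map_toFun T m φ, ← antiDistFunctor_map_toFun T m ψ, h])

instance : (antiDistFunctor.{u} T m).Full where
  map_surjective {X Y} F := by
    obtain ⟨φ, hφ⟩ := AntiMap.exists_pull_eq (X := X.space.carrier) (Y := Y.space.carrier)
      F.unop.isLaxHom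
    exact ⟨φ, Quiver.Hom.unop_inj (BCC.Hom.ext hφ)⟩

instance : (antiDistFunctor.{u} T m).EssSurj where
  mem_essImage Z := by
    obtain ⟨g, hg, hg', hg''⟩ := exists_inverse_ev T m Z.unop.property
    let e : Z.unop ≅ antiDistObj T m ⟨spectrumObj Z.unop.obj⟩ :=
      { hom := ⟨Spectrum.ev, Spectrum.isPowHom_ev.isLaxHom⟩
        inv := ⟨g, hg.isLaxHom⟩
        hom_inv_id := BCC.Hom.ext (funext hg'')
        inv_hom_id := BCC.Hom.ext (funext hg') }
    exact ⟨⟨spectrumObj Z.unop.obj⟩, ⟨e.op⟩⟩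

instance : (antiDistFunctor.{u} T m).IsEquivalence where

end Equivalences

end UnitDuality

theorem mainTheorem1 :
    (Nonempty (UnitDuality.PosCompDist.{u} ≌
        (UnitDuality.BCC.{u} UnitDuality.mulQuantale True)ᵒᵖ) ∧
      Nonempty (UnitDuality.PosComp.{u} ≌
        (UnitDuality.ACC.{u} UnitDuality.mulQuantale True)ᵒᵖ)) ∧
    (Nonempty (UnitDuality.PosCompDist.{u} ≌
        (UnitDuality.BCC.{u} UnitDuality.lukQuantale False)ᵒᵖ) ∧
      Nonempty (UnitDuality.PosComp.{u} ≌
        (UnitDuality.ACC.{u} UnitDuality.lukQuantale False)ᵒᵖ)) :=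
  ⟨⟨⟨(UnitDuality.antiDistFunctor _ _).asEquivalence⟩,
      ⟨(UnitDuality.antiFunctor _ _).asEquivalence⟩⟩,
    ⟨⟨(UnitDuality.antiDistFunctor _ _).asEquivalence⟩,
      ⟨(UnitDuality.antiFunctor _ _).asEquivalence⟩⟩⟩
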